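/- **Setting.** Consider stabiliser circuits (qubit preparations, Clifford gates, Pauli measurements with outcomes in $\{0,1\}$, Paulis controlled by parities of earlier outcomes). A fault places a Pauli, up to phase, on each fault location; atomic faults are those of circuit-level noise, where any components may be idealised (a Pauli measurement idealised as *fault-tolerant* has as atomic faults only: a measurement flip, i.e. an anticommuting Pauli directly before and after it, possibly multiplied by a Pauli on exactly one output). The weight $wt(F)$ of a fault in the group generated by the atomic faults is the least number of atomic faults generating it. A fault is *detectable* if it flips the parity of a set of measurements whose parity is predetermined in the fault-free circuit. A circuit may come with affine parity constraints on its outcomes (post-selection) and with reported outcomes, which are parities of its measurement outcomes; it is *total* if its fault-free linear map is non-zero only for outcomes that satisfy the constraints. Two circuits are *$w$-fault-equivalent* if they can report the same outcomes under their constraints, and every fault $F_1$ of weight $<w$ on either one is detectable or there is a fault $F_2$ on the other one with $wt(F_2)\le wt(F_1)$ such that the two faulty circuits, for all outcomes satisfying the constraints and giving the same reported outcomes, are equal up to a non-zero scalar. They are *fault-equivalent* if this holds for all $w\in\mathbb N$. The idealised $n$-legged cat state is a fault-free preparation of $|0\rangle^{\otimes n}+|1\rangle^{\otimes n}$ (up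 to normalisation) whose only atomic faults are single-qubit Paulis on the legs. A circuit *fault-tolerantly prepares* the $n$-legged cat state if it is fault-equivalent to it. A circuit *fault-tolerantly measures* $ZZ$ if it is fault-equivalent to the measurement of $ZZ$ idealised as fault-tolerant, with flips on its input and output wires and with its outcome reported. **Proposition.** Let $n\ge 0$, let $C_0,C_1$ be total circuits that fault-tolerantly prepare the $n$-legged cat state, and let $M_1,\dots,M_n$ be total circuits that fault-tolerantly measure $ZZ$. Prepare the two cat states with $C_0$ and $C_1$, measure $ZZ$ between the $i$-th legs of the two with $M_i$, with reported outcome $k_i$, for $i=1,\dots,n$, apply $X^{k_i}$ to the $i$-th leg of the second cat state, and output all $2n$ legs, each with a fault location; impose the constraints of $C_0,C_1,M_1,\dots,M_n$ and $k_1=\dots=k_n$. Then the resulting circuit fault-tolerantly prepares the $2n$-legged cat state, i.e. it is $w$-fault-equivalent to the idealised $2n$-legged cat state for every $w\in\mathbb N$, and it is total. The same holds with $Z$ and $X$ exchanged: for the cat states $|+\rangle^{\otimes n}+|-\rangle^{\otimes n}$, checks $XX$ and corrections $Z^{k_i}$. -/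

import Mathlib

/-!
Stabiliser circuits with measurement outcomes, Pauli faults, circuit-level noise with idealised
components, detectable faults, fault equivalence, and the doubling construction for cat states.
-/

noncomputable section

namespace CatDoubling

/-! ### Paulis -/

/-- A single-qubit Pauli operator up to phase; `(x, z)` stands for `X ^ x * Z ^ z`.
The group law is multiplication of Paulis modulo phases. -/
abbrev Pauli : Type := ZMod 2 × ZMod 2

/-- The `2 × 2` matrix of a Pauli: the usual Hermitian matrices `I`, `X`, `Z` and `Y = i X Z`. -/
def pauliMatrix (p : Pauli) : Matrix (ZMod 2) (ZMod 2) ℂ := fun s t =>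
  if s = t + p.1 then
    (if p.1 = 1 ∧ p.2 = 1 then Complex.I else 1) * (if p.2 = 1 ∧ t = 1 then -1 else 1)
  else 0

/-- Linear maps from the qubits labelled by `a` to the qubits labelled by `b`, as matrices in the
computational basis. -/
abbrev QMap (a b : Type) : Type := Matrix (b → ZMod 2) (a → ZMod 2) ℂ

/-- The Pauli string `⊗ j, P j` on the wires `a`. -/
def pauliString {a : Type} [Fintype a] (P : a → Pauli) : QMap a a := fun x y =>
  ∏ j, pauliMatrix (P j) (x j) (y j)

/-- Two Pauli strings anticommute. -/
def Anticommute {a : Type} [Fintype a] (P Q : a → Pauli) : Prop :=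
  ∑ j, ((P j).1 * (Q j).2 + (P j).2 * (Q j).1) = 1

/-- A Pauli string that acts non-trivially on exactly one wire. -/
def IsSingleFlip {a : Type} (P : a → Pauli) : Prop :=
  ∃ j, P j ≠ 0 ∧ ∀ j', j' ≠ j → P j' = 0

/-! ### Parities of measurement outcomes -/

/-- An affine parity `k_{v₁} ⊕ … ⊕ k_{vₘ} ⊕ const` of boolean outcomes labelled by `o`
(terms that are listed twice cancel). -/
structure ParityForm (o : Type) where
  terms : Multiset o
  const : ZMod 2

namespace ParityForm

/-- The value of a parity at an outcome assignment. -/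
def eval {o : Type} (f : ParityForm o) (k : o → ZMod 2) : ZMod 2 :=
  f.const + (f.terms.map k).sum

/-- The same parity over renamed outcomes. -/
def map {o o' : Type} (g : o → o') (f : ParityForm o) : ParityForm o' :=
  ⟨f.terms.map g, f.const⟩

/-- The parity consisting of a single outcome. -/
def single {o : Type} (v : o) : ParityForm o := ⟨{v}, 0⟩

/-- The exclusive or of two parities. -/
def xor {o : Type} (f g : ParityForm o) : ParityForm o := ⟨f.terms + g.terms, f.const + g.const⟩

end ParityForm

/-! ### Cat states in the `Z` and in the `X` basis -/

/-- The basis in which a cat state is a superposition of two constant strings. -/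
inductive CatBasis where
  | Z
  | X

/-- The `s`-th basis vector: `|0⟩, |1⟩` for `Z`, and `|+⟩, |-⟩` (unnormalised) for `X`. -/
def CatBasis.vec (B : CatBasis) (s t : ZMod 2) : ℂ :=
  match B with
  | .Z => if s = t then 1 else 0
  | .X => if s = 1 ∧ t = 1 then -1 else 1

/-- The Pauli of the parity checks: `Z` for `|0⟩, |1⟩` and `X` for `|+⟩, |-⟩`. -/
def CatBasis.check (B : CatBasis) : Pauli :=
  match B with
  | .Z => (0, 1)
  | .X => (1, 0)

/-- The Pauli that exchanges the two basis vectors. -/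
def CatBasis.flip (B : CatBasis) : Pauli :=
  match B with
  | .Z => (1, 0)
  | .X => (0, 1)

/-! ### Circuits -/

/-- Clifford gates and state preparations, with input wires and output wires. -/
inductive Gate : Type → Type → Type 1 where
  /-- preparation of `|0⟩` -/
  | zero : Gate (Fin 0) (Fin 1)
  | hadamard : Gate (Fin 1) (Fin 1)
  /-- the phase gate `S` -/
  | phase : Gate (Fin 1) (Fin 1)
  /-- wire `0` is the control, wire `1` the target -/
  | cnot : Gate (Fin 2) (Fin 2)
  /-- preparation of an `n`-legged cat state -/
  | cat (B : CatBasis) (n : ℕ) : Gate (Fin 0) (Fin n)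

open Classical in
/-- The linear map of a gate. The cat state is `|0…0⟩ + |1…1⟩` (respectively `|+…+⟩ + |-…-⟩`),
up to normalisation. -/
def Gate.toMap {a b : Type} : Gate a b → QMap a b
  | .zero => fun x _ => if x 0 = 0 then 1 else 0
  | .hadamard => fun x y =>
      (((Real.sqrt 2)⁻¹ : ℝ) : ℂ) * (if x 0 = 1 ∧ y 0 = 1 then -1 else 1)
  | .phase => fun x y => if x = y then (if y 0 = 1 then Complex.I else 1) else 0
  | .cnot => fun x y => if x 0 = y 0 ∧ x 1 = y 1 + y 0 then 1 else 0
  | .cat B _ => fun x _ => ∑ s : ZMod 2, ∏ i, B.vec s (x i)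

/-- How far a Pauli measurement is idealised. -/
inductive MeasNoise where
  | noisy
  | faultTolerant
  | faultFree

/-- `Circuit c o a b`: stabiliser circuits from the wires `a` to the wires `b` whose measurement
outcomes are labelled by `o`, and which may use classical bits labelled by `c` as controls.
In a sequential composition the second circuit may use the outcomes of the first one. -/
inductive Circuit : Type → Type → Type → Type → Type 1 where
  /-- One fault location on each of the wires `a` (idealised wires are simply not followed by
  this). -/
  | wires {c a : Type} [Fintype a] : Circuit c Empty a a
  /-- A gate, which is non-idealised if `noisy` is true and fault-free otherwise. -/
  | gate {c a b : Type} [Fintype b] (noisy : Bool) (g : Gate a b) : Circuit c Empty a b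
  /-- Non-destructive measurement of the Pauli string `P`. -/
  | measure {c a : Type} [Fintype a] (N : MeasNoise) (P : a → Pauli) : Circuit c Unit a a
  /-- Destructive measurement of a qubit in the computational basis. -/
  | destroy {c : Type} (noisy : Bool) : Circuit c Unit (Fin 1) (Fin 0)
  /-- Classically controlled Paulis: `P j` is applied to the wire `j` iff the parity `f j` of the
  classical bits is `1`. As for every single-qubit gate, the faults of these gates are the flips of
  their output wires, so they are recorded by `wires`. -/
  | correct {c a : Type} [Fintype a] (P : a → Pauli) (f : a → ParityForm c) : Circuit c Empty a a
  /-- Sequential composition, the first circuit first. -/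
  | seq {c o₁ o₂ a b d : Type} [Fintype b] (C₁ : Circuit c o₁ a b)
      (C₂ : Circuit (c ⊕ o₁) o₂ b d) : Circuit c (o₁ ⊕ o₂) a d
  /-- Parallel composition of a finite family. -/
  | par {c ι : Type} [Fintype ι] {o a b : ι → Type} (C : ∀ i, Circuit c (o i) (a i) (b i)) :
      Circuit c (Σ i, o i) (Σ i, a i) (Σ i, b i)
  /-- Renaming of controls, outcomes and wires. -/
  | relabel {c o a b c' o' a' b' : Type} (fc : c → c') (eo : o ≃ o') (ea : a ≃ a') (eb : b ≃ b')
      (C : Circuit c o a b) : Circuit c' o' a' b'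

namespace Circuit

/-- The fault locations. The places directly before and directly after a measurement are recorded
with that measurement. Several locations may lie on one physical wire segment; their Paulis then
simply multiply in the faulty circuit. -/
def Loc {c o a b : Type} : Circuit c o a b → Type
  | wires (a := a) => a
  | gate (b := b) _ _ => b
  | measure (a := a) _ _ => a ⊕ a
  | destroy _ => Fin 1
  | correct _ _ => Empty
  | seq C₁ C₂ => C₁.Loc ⊕ C₂.Loc
  | par C => Σ i, (C i).Loc
  | relabel _ _ _ _ C => C.Loc

/-- A fault: a Pauli, up to phase, at each fault location. -/
abbrev Fault {c o a b : Type} (C : Circuit c o a b) : Type := C.Loc → Pauli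

open Classical in
/-- The linear map of the circuit with the fault `F` inserted, for given classical controls `κ`
and measurement outcomes `k`. -/
def sem {c o a b : Type} :
    (C : Circuit c o a b) → C.Fault → (c → ZMod 2) → (o → ZMod 2) → QMap a b
  | wires, F, _, _ => pauliString F
  | gate (b := b) _ g, F, _, _ => pauliString (a := b) F * g.toMap
  | measure _ P, F, _, k =>
      pauliString (fun j => F (Sum.inr j)) *
        ((1 / 2 : ℂ) • (1 + (if k () = 1 then (-1 : ℂ) else 1) • pauliString P)) *
          pauliString (fun j => F (Sum.inl j))
  | destroy _, F, _, k => fun _ y => pauliMatrix (F (0 : Fin 1)) (k ()) (y 0)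
  | correct P f, _, κ, _ => pauliString (fun j => if (f j).eval κ = 1 then P j else 0)
  | seq C₁ C₂, F, κ, k =>
      C₂.sem (fun l => F (Sum.inr l)) (Sum.elim κ (fun v => k (Sum.inl v)))
          (fun v => k (Sum.inr v)) *
        C₁.sem (fun l => F (Sum.inl l)) κ (fun v => k (Sum.inl v))
  | par C, F, κ, k => fun x y =>
      ∏ i, (C i).sem (fun l => F ⟨i, l⟩) κ (fun v => k ⟨i, v⟩)
        (fun j => x ⟨i, j⟩) (fun j => y ⟨i, j⟩)
  | relabel fc eo ea eb C, F, κ, k => fun x y =>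
      C.sem F (fun v => κ (fc v)) (fun v => k (eo v)) (fun j => x (eb j)) (fun j => y (ea j))

/-- The atomic faults of circuit-level noise, with the idealisations that the circuit records. -/
def atoms {c o a b : Type} : (C : Circuit c o a b) → Set C.Fault
  | wires (a := a) => {F : a → Pauli | IsSingleFlip F}
  | gate (b := b) noisy _ => {F : b → Pauli | noisy = true ∧ F ≠ 0}
  | measure (a := a) N P => {F : a ⊕ a → Pauli |
      match N with
      | .noisy =>
          -- a gate fault
          (∃ R : a → Pauli, R ≠ 0 ∧ F = Sum.elim (fun _ => 0) R) ∨
          -- a measurement flip, possibly with a fault on any subset of the outputs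
          (∃ Q R : a → Pauli, Anticommute P Q ∧ F = Sum.elim Q (Q + R))
      | .faultTolerant =>
          -- a measurement flip, possibly with a fault on exactly one output
          ∃ Q R : a → Pauli, Anticommute P Q ∧ (R = 0 ∨ IsSingleFlip R) ∧ F = Sum.elim Q (Q + R)
      | .faultFree => False}
  | destroy noisy => {F : Fin 1 → Pauli | noisy = true ∧ (F 0).1 = 1}
  | correct _ _ => ∅
  | seq C₁ C₂ => {F | (∃ G ∈ C₁.atoms, F = Sum.elim G (fun _ => 0)) ∨
      (∃ G ∈ C₂.atoms, F = Sum.elim (fun _ => 0) G)}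
  | par C => {F | ∃ i, (fun l => F ⟨i, l⟩) ∈ (C i).atoms ∧ ∀ j, j ≠ i → ∀ l, F ⟨j, l⟩ = 0}
  | relabel _ _ _ _ C => C.atoms

/-- The faults that can occur: the group generated by the atomic faults. -/
def faultGroup {c o a b : Type} (C : Circuit c o a b) : AddSubgroup C.Fault :=
  AddSubgroup.closure C.atoms

/-- The weight of a fault: the least number of atomic faults that generate it. -/
def wt {c o a b : Type} (C : Circuit c o a b) (F : C.Fault) : ℕ :=
  sInf {m | ∃ L : List C.Fault, (∀ G ∈ L, G ∈ C.atoms) ∧ L.sum = F ∧ L.length = m}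

/-- In the circuit with the fault `F`, every outcome that can occur gives the parity `f` the
value `β`. -/
def Predetermined {o a b : Type} (C : Circuit Empty o a b) (F : C.Fault) (f : ParityForm o)
    (β : ZMod 2) : Prop :=
  ∀ k, C.sem F Empty.elim k ≠ 0 → f.eval k = β

/-- A fault is detectable if it flips the parity of a detecting set, i.e. of a set of measurements
whose parity is predetermined in the fault-free circuit. -/
def Detectable {o a b : Type} (C : Circuit Empty o a b) (F : C.Fault) : Prop :=
  ∃ f β, C.Predetermined 0 f β ∧ C.Predetermined F f (β + 1)

end Circuit

/-! ### Circuits with constrained outcomes and fault equivalence -/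

/-- A circuit from the wires `a` to the wires `b` with linear constraints on its outcomes (each
listed parity has to be `0`), and with parities of its outcomes, labelled by `ρ`, that are the
outcomes it reports. -/
structure Protocol (ρ a b : Type) where
  Outcome : Type
  circuit : Circuit Empty Outcome a b
  constraints : Set (ParityForm Outcome)
  readout : ρ → ParityForm Outcome

namespace Protocol

variable {ρ a b : Type}

/-- The outcome assignment `k` satisfies the constraints. -/
def Admissible (D : Protocol ρ a b) (k : D.Outcome → ZMod 2) : Prop :=
  ∀ f ∈ D.constraints, f.eval k = 0

/-- The reported outcomes. -/
def report (D : Protocol ρ a b) (k : D.Outcome → ZMod 2) : ρ → ZMod 2 :=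
  fun r => (D.readout r).eval k

/-- The fault-free circuit is non-zero only for outcomes that satisfy the constraints, so that
nothing is ever discarded in the absence of faults. -/
def Total (D : Protocol ρ a b) : Prop :=
  ∀ k, D.circuit.sem 0 Empty.elim k ≠ 0 → D.Admissible k

/-- The two faulty circuits are equal: whenever they satisfy their constraints and report the same
outcomes, they are the same linear map up to a non-zero scalar. -/
def SameMap (D₁ D₂ : Protocol ρ a b) (F₁ : D₁.circuit.Fault) (F₂ : D₂.circuit.Fault) : Prop :=
  ∀ k₁ k₂, D₁.Admissible k₁ → D₂.Admissible k₂ → D₁.report k₁ = D₂.report k₂ →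
    ∃ z : ℂ, z ≠ 0 ∧ D₁.circuit.sem F₁ Empty.elim k₁ = z • D₂.circuit.sem F₂ Empty.elim k₂

/-- Every fault of `D₁` of weight less than `w` is detectable, or has an equal fault of at most
the same weight on `D₂`. -/
def Simulates (w : ℕ) (D₁ D₂ : Protocol ρ a b) : Prop :=
  ∀ F₁ ∈ D₁.circuit.faultGroup, D₁.circuit.wt F₁ < w →
    D₁.circuit.Detectable F₁ ∨
      ∃ F₂ ∈ D₂.circuit.faultGroup, D₂.circuit.wt F₂ ≤ D₁.circuit.wt F₁ ∧ SameMap D₁ D₂ F₁ F₂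

/-- `w`-fault equivalence. The first clause says that both sides can report the same outcomes;
when nothing is reported, it says that the constraints are satisfiable on both sides or on
neither. -/
def WFaultEquiv (w : ℕ) (D₁ D₂ : Protocol ρ a b) : Prop :=
  (D₁.report '' {k | D₁.Admissible k} = D₂.report '' {k | D₂.Admissible k}) ∧
    Simulates w D₁ D₂ ∧ Simulates w D₂ D₁

/-- Fault equivalence. -/
def FaultEquiv (D₁ D₂ : Protocol ρ a b) : Prop := ∀ w : ℕ, WFaultEquiv w D₁ D₂

end Protocol

/-! ### Idealised specifications -/

/-- The idealised `n`-legged cat state: a fault-free preparation, the only faults being flips of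
the legs. -/
def idealCat (B : CatBasis) (n : ℕ) : Protocol Empty (Fin 0) (Fin n) where
  Outcome := Empty ⊕ Empty
  circuit := .seq (.gate false (.cat B n)) .wires
  constraints := ∅
  readout := Empty.elim

/-- The fault-tolerant measurement of the two-qubit parity check `ZZ` (for `B = Z`) or `XX` (for
`B = X`): flips of the input and output wires, and the faults of an idealised fault-tolerant
measurement. Its outcome is reported. -/
def idealCheck (B : CatBasis) : Protocol Unit (Fin 2) (Fin 2) where
  Outcome := Empty ⊕ (Unit ⊕ Empty)
  circuit := .seq .wires (.seq (.measure .faultTolerant (fun _ => B.check)) .wires)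
  constraints := ∅
  readout := fun _ => .single (Sum.inr (Sum.inl ()))

/-- A protocol that fault-tolerantly prepares the `n`-legged cat state, for every weight. -/
def FaultTolerantCat (B : CatBasis) (n : ℕ) (D : Protocol Empty (Fin 0) (Fin n)) : Prop :=
  D.FaultEquiv (idealCat B n)

/-- A protocol that fault-tolerantly measures the two-qubit parity check, for every weight. -/
def FaultTolerantCheck (B : CatBasis) (D : Protocol Unit (Fin 2) (Fin 2)) : Prop :=
  D.FaultEquiv (idealCheck B)

/-! ### The doubling construction -/

section Doubling

variable (B : CatBasis) (n : ℕ) (C : Fin 2 → Protocol Empty (Fin 0) (Fin n))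
  (M : Fin n → Protocol Unit (Fin 2) (Fin 2))

/-- The outcomes of the two preparations. -/
abbrev PrepOutcome : Type := Σ s, (C s).Outcome

/-- The outcomes of the `n` parity checks. -/
abbrev CheckOutcome : Type := Σ i, (M i).Outcome

/-- The two `n`-legged preparations next to each other; the wire `(s, i)` is the leg `i` of the
cat state `s`. -/
def twoCats : Circuit Empty (PrepOutcome n C) (Fin 0) (Fin 2 × Fin n) :=
  .relabel id (Equiv.refl _) ((Equiv.sigmaEquivProd (Fin 2) (Fin 0)).trans (Equiv.equivOfIsEmpty _ _))
    (Equiv.sigmaEquivProd (Fin 2) (Fin n))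
    (.par fun s => (C s).circuit)

/-- The transversal parity checks: the check `i` acts on the legs `(0, i)` and `(1, i)`. -/
def transversalChecks (c : Type) :
    Circuit c (CheckOutcome n M) (Fin 2 × Fin n) (Fin 2 × Fin n) :=
  .relabel Empty.elim (Equiv.refl _)
    ((Equiv.sigmaEquivProd (Fin n) (Fin 2)).trans (Equiv.prodComm (Fin n) (Fin 2)))
    ((Equiv.sigmaEquivProd (Fin n) (Fin 2)).trans (Equiv.prodComm (Fin n) (Fin 2)))
    (.par fun i => (M i).circuit)

/-- All outcomes of the doubling construction (the two `Empty`s belong to the correction and to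
the output wires, which have no outcomes). -/
abbrev DoubledOutcome : Type := ((PrepOutcome n C ⊕ CheckOutcome n M) ⊕ Empty) ⊕ Empty

/-- An outcome of the preparation `s`, among all outcomes. -/
def prepOutcome (s : Fin 2) (v : (C s).Outcome) : DoubledOutcome n C M :=
  Sum.inl (Sum.inl (Sum.inl ⟨s, v⟩))

/-- An outcome of the check `i`, among all outcomes. -/
def checkOutcome (i : Fin n) (v : (M i).Outcome) : DoubledOutcome n C M :=
  Sum.inl (Sum.inl (Sum.inr ⟨i, v⟩))

/-- The doubling construction: prepare two `n`-legged cat states, measure the `n` transversal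
parity checks, with reported outcomes `k i`, apply the flip Pauli to the leg `i` of the second cat
state iff `k i = 1`, and keep all `2 n` legs, each with a fault location, as outputs. The outcomes
are post-selected on the constraints of the ingredients and on `k i = k j` for all `i`, `j`. -/
def doubledCat : Protocol Empty (Fin 0) (Fin (2 * n)) where
  Outcome := DoubledOutcome n C M
  circuit :=
    .relabel id (Equiv.refl _) (Equiv.refl _) (finProdFinEquiv : Fin 2 × Fin n ≃ Fin (2 * n))
      (.seq (.seq (.seq (twoCats n C) (transversalChecks n M _))
        (.correct (fun q => if q.1 = 1 then B.flip else 0)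
          (fun q => ((M q.2).readout ()).map fun v => Sum.inr (Sum.inr ⟨q.2, v⟩))))
        .wires)
  constraints :=
    {g | (∃ s, ∃ f ∈ (C s).constraints, g = f.map (prepOutcome n C M s)) ∨
      (∃ i, ∃ f ∈ (M i).constraints, g = f.map (checkOutcome n C M i)) ∨
      (∃ i j, g = (((M i).readout ()).map (checkOutcome n C M i)).xor
        (((M j).readout ()).map (checkOutcome n C M j)))}
  readout := Empty.elim

end Doubling

end CatDoubling

end

noncomputable section

namespace CatDoubling

/-! ### Equality up to a non-zero scalar -/

/-! Everything is computed up to non-zero scalars and for both bases at once: a Pauli has a part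
along `B.flip`, which exchanges the two basis vectors, and a part along `B.check`, which only gives
signs.

Take an undetectable fault made of `t` atomic faults. A detecting set of an ingredient is also one
of the whole circuit, so the faults on the ingredients are undetectable there. Fault equivalence
then replaces each faulty preparation by a cat state with a Pauli `P` whose number of flips is at
most its weight. Likewise, each faulty check `i` becomes an ideal check with outcome shifted by `m
i`, followed by a Pauli `E`; a non-zero shift costs at least one fault. Moving `P` through the
checks makes the total shift in row `i` equal to `m i` plus the flips of `P` on both legs of that
row. Two cat states survive the ideal checks only if all the measured values agree. The faulty
circuit is non-zero on some outcome satisfying the constraints, so the total shifts have a common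
value `δ`. Non-vanishing is where totality enters: by `exists_propagation` a fault only shifts
outcomes and adds an output Pauli, and an undetectable shift respects the constraints of a total
circuit (`Total.admissible_add`).

The result is the large cat state with the Pauli `O + E + P` (`O` on the outputs) and, if `δ = 1`, a
wrong flip of the whole second block. For `δ = 0` the flips are at most `t`. For `δ = 1` every row
contains a fault on its check or a flip of `P`, so `n ≤ t`; flipping all `2n` legs fixes the cat
state, and either the Pauli or its complement has at most `n` flips (`flipWeight_doubled_le`). The
check parts matter only through their total parity, which one leg can carry, if possible one that is
flipped already (`exists_support_le`). Thus at most `t` single-leg faults suffice.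

Conversely, leg faults of the ideal cat state are faults on the output wires of the doubled circuit,
of no larger weight. -/

/-- Two matrices agree up to a non-zero scalar. -/
def ScalarEq {r s : Type} (A A' : Matrix r s ℂ) : Prop := ∃ z : ℂ, z ≠ 0 ∧ A = z • A'

infix:50 " ∝ " => ScalarEq

namespace ScalarEq

variable {r s t : Type} {A A' A'' : Matrix r s ℂ}

theorem refl (A : Matrix r s ℂ) : A ∝ A := ⟨1, one_ne_zero, (one_smul _ _).symm⟩

theorem of_eq (h : A = A') : A ∝ A' := h ▸ refl A

theorem symm (h : A ∝ A') : A' ∝ A := by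
  obtain ⟨z, hz, rfl⟩ := h
  exact ⟨z⁻¹, inv_ne_zero hz, by rw [smul_smul, inv_mul_cancel₀ hz, one_smul]⟩

theorem trans (h : A ∝ A') (h' : A' ∝ A'') : A ∝ A'' := by
  obtain ⟨z, hz, rfl⟩ := h
  obtain ⟨w, hw, rfl⟩ := h'
  exact ⟨z * w, mul_ne_zero hz hw, smul_smul _ _ _⟩

theorem ne_zero_iff (h : A ∝ A') : A ≠ 0 ↔ A' ≠ 0 := by
  obtain ⟨z, hz, rfl⟩ := h
  simp [hz]

theorem mul [Fintype s] {C C' : Matrix s t ℂ} (h : A ∝ A') (h' : C ∝ C') : A * C ∝ A' * C' := by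
  obtain ⟨z, hz, rfl⟩ := h
  obtain ⟨w, hw, rfl⟩ := h'
  exact ⟨z * w, mul_ne_zero hz hw, by rw [Matrix.smul_mul, Matrix.mul_smul, smul_smul]⟩

theorem mul_left [Fintype s] {C C' : Matrix s t ℂ} (A : Matrix r s ℂ) (h : C ∝ C') :
    A * C ∝ A * C' := (refl A).mul h

theorem mul_right [Fintype s] (h : A ∝ A') (C : Matrix s t ℂ) : A * C ∝ A' * C :=
  h.mul (refl C)

theorem submatrix {r' s' : Type} (h : A ∝ A') (f : r' → r) (g : s' → s) :
    A.submatrix f g ∝ A'.submatrix f g := by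
  obtain ⟨z, hz, rfl⟩ := h
  exact ⟨z, hz, rfl⟩

end ScalarEq

/-! ### Signs and the Pauli group -/

/-- The sign `(-1) ^ a`. -/
def sgn (a : ZMod 2) : ℂ := if a = 1 then -1 else 1

@[simp] theorem sgn_zero : sgn 0 = 1 := by simp [sgn]

@[simp] theorem sgn_one : sgn 1 = -1 := by simp [sgn]

theorem zmod_two_cases (a : ZMod 2) : a = 0 ∨ a = 1 := by
  revert a; decide

theorem zmod_two_add_self {α : Type} [AddCommGroup α] [Module (ZMod 2) α] (a : α) : a + a = 0 :=
  ZModModule.add_self a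

theorem sgn_add (a b : ZMod 2) : sgn (a + b) = sgn a * sgn b := by
  rcases zmod_two_cases a with rfl | rfl <;> rcases zmod_two_cases b with rfl | rfl <;>
    simp [zmod_two_add_self]

theorem sgn_ne_zero (a : ZMod 2) : sgn a ≠ 0 := by
  unfold sgn; split_ifs <;> norm_num

theorem sgn_mul_self (a : ZMod 2) : sgn a * sgn a = 1 := by
  rw [← sgn_add, zmod_two_add_self, sgn_zero]

theorem sgn_sum {ι : Type} (s : Finset ι) (f : ι → ZMod 2) :
    sgn (∑ i ∈ s, f i) = ∏ i ∈ s, sgn (f i) := by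
  classical
  induction s using Finset.induction_on with
  | empty => simp
  | insert i s hi ih => rw [Finset.sum_insert hi, Finset.prod_insert hi, sgn_add, ih]

/-- The phase that distinguishes `Y` from `X * Z`. -/
def pauliPhase (p : Pauli) : ℂ := if p.1 = 1 ∧ p.2 = 1 then Complex.I else 1

theorem pauliPhase_ne_zero (p : Pauli) : pauliPhase p ≠ 0 := by
  unfold pauliPhase; split_ifs <;> simp

theorem pauliMatrix_apply (p : Pauli) (s t : ZMod 2) :
    pauliMatrix p s t = if s = t + p.1 then pauliPhase p * sgn (p.2 * t) else 0 := by
  unfold pauliMatrix pauliPhase sgn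
  congr 2
  rcases zmod_two_cases p.2 with h | h <;> simp [h]

theorem pauliMatrix_zero : pauliMatrix 0 = 1 := by
  ext s t
  simp [pauliMatrix_apply, pauliPhase, Matrix.one_apply]

/-- The symplectic form: `1` iff the two Paulis anticommute. -/
def symp (p q : Pauli) : ZMod 2 := p.1 * q.2 + p.2 * q.1

theorem pauliMatrix_mul_apply (p q : Pauli) (s t : ZMod 2) :
    (pauliMatrix p * pauliMatrix q) s t =
      if s = t + (p + q).1 then
        pauliPhase p * pauliPhase q * sgn (p.2 * q.1) * sgn ((p + q).2 * t) else 0 := by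
  rw [Matrix.mul_apply, Finset.sum_eq_single (t + q.1)]
  · have h : t + q.1 + p.1 = t + (p + q).1 := by rw [Prod.fst_add]; ring
    rw [pauliMatrix_apply, pauliMatrix_apply, if_pos rfl, h]
    split_ifs with h'
    · rw [Prod.snd_add, mul_add, add_mul, sgn_add, sgn_add]; ring
    · simp
  · intro r _ hr
    rw [pauliMatrix_apply q, if_neg hr, mul_zero]
  · simp

theorem pauliMatrix_mul (p q : Pauli) : pauliMatrix p * pauliMatrix q ∝ pauliMatrix (p + q) := by
  refine ⟨pauliPhase p * pauliPhase q * sgn (p.2 * q.1) * (pauliPhase (p + q))⁻¹, ?_, ?_⟩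
  · simp [pauliPhase_ne_zero, sgn_ne_zero]
  · ext s t
    rw [pauliMatrix_mul_apply, Matrix.smul_apply, pauliMatrix_apply, smul_eq_mul]
    split_ifs
    · have := pauliPhase_ne_zero (p + q)
      field_simp
    · simp

/-- Both products are the same matrix up to the sign from moving `Z` past `X`, which the symplectic
form records. -/
theorem pauliMatrix_comm (p q : Pauli) :
    pauliMatrix p * pauliMatrix q = sgn (symp p q) • (pauliMatrix q * pauliMatrix p) := by
  ext s t
  rw [Matrix.smul_apply, pauliMatrix_mul_apply, pauliMatrix_mul_apply, add_comm q p, smul_eq_mul]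
  split_ifs
  · have := sgn_mul_self (q.2 * p.1)
    rw [symp, sgn_add, mul_comm p.1 q.2]
    linear_combination
      (-(pauliPhase p * pauliPhase q * sgn (p.2 * q.1) * sgn ((p + q).2 * t))) * this
  · simp

/-! ### Tensor products -/

section Tensor

variable {ι : Type} [Fintype ι] {α β γ : ι → Type}

/-- The tensor product of a finite family of linear maps. -/
def kron (A : ∀ i, QMap (α i) (β i)) : QMap (Σ i, α i) (Σ i, β i) := fun x y =>
  ∏ i, A i (fun j => x ⟨i, j⟩) (fun j => y ⟨i, j⟩)

theorem sum_prod_sigma [∀ i, Fintype (β i)] [DecidableEq (Σ i, β i)] [∀ i, DecidableEq (β i)]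
    (f : ∀ i, (β i → ZMod 2) → ℂ) :
    ∑ w : (Σ i, β i) → ZMod 2, ∏ i, f i (fun j => w ⟨i, j⟩) = ∏ i, ∑ w, f i w := by
  classical
  rw [Finset.prod_univ_sum, Fintype.piFinset_univ]
  exact Fintype.sum_equiv (Equiv.piCurry fun _ _ => ZMod 2) _ _ fun w => rfl

theorem kron_mul [∀ i, Fintype (β i)] [DecidableEq (Σ i, β i)] [∀ i, DecidableEq (β i)]
    (A : ∀ i, QMap (β i) (γ i)) (A' : ∀ i, QMap (α i) (β i)) :
    kron A * kron A' = kron fun i => A i * A' i := by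
  ext x y
  simp only [Matrix.mul_apply, kron, ← Finset.prod_mul_distrib]
  exact sum_prod_sigma fun i w => A i (fun j => x ⟨i, j⟩) w * A' i w (fun j => y ⟨i, j⟩)

theorem kron_smul (z : ι → ℂ) (A : ∀ i, QMap (α i) (β i)) :
    kron (fun i => z i • A i) = (∏ i, z i) • kron A := by
  ext x y
  simp [kron, Finset.prod_mul_distrib]

theorem ScalarEq.kron {A A' : ∀ i, QMap (α i) (β i)} (h : ∀ i, A i ∝ A' i) :
    CatDoubling.kron A ∝ CatDoubling.kron A' := by
  choose z hz h using h
  refine ⟨∏ i, z i, Finset.prod_ne_zero_iff.2 fun i _ => hz i, ?_⟩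
  rw [← kron_smul, funext h]

theorem pauliString_sigma [∀ i, Fintype (α i)] [Fintype (Σ i, α i)] (P : (Σ i, α i) → Pauli) :
    pauliString P = kron fun i => pauliString fun j => P ⟨i, j⟩ := by
  obtain rfl : ‹Fintype (Σ i, α i)› = Sigma.instFintype := Subsingleton.elim _ _
  ext x y
  exact Fintype.prod_sigma _

end Tensor

/-! ### Pauli strings -/

section PauliString

variable {a : Type} [Fintype a]

theorem pauliString_mul_apply [DecidableEq a] (P Q : a → Pauli) :
    pauliString P * pauliString Q =
      fun x y => ∏ j, (pauliMatrix (P j) * pauliMatrix (Q j)) (x j) (y j) := by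
  ext x y
  simp only [Matrix.mul_apply, pauliString, ← Finset.prod_mul_distrib]
  rw [Finset.prod_univ_sum, Fintype.piFinset_univ]

theorem pauliString_mul [DecidableEq a] (P Q : a → Pauli) :
    pauliString P * pauliString Q ∝ pauliString (P + Q) := by
  choose z hz h using fun j => pauliMatrix_mul (P j) (Q j)
  refine ⟨∏ j, z j, Finset.prod_ne_zero_iff.2 fun j _ => hz j, ?_⟩
  ext x y
  rw [pauliString_mul_apply]
  simp [h, pauliString, Finset.prod_mul_distrib]

/-- The symplectic form of two Pauli strings. -/
def sympl (P Q : a → Pauli) : ZMod 2 := ∑ j, symp (P j) (Q j)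

theorem sympl_zero_right (P : a → Pauli) : sympl P 0 = 0 := by simp [sympl, symp]

theorem pauliString_comm [DecidableEq a] (P Q : a → Pauli) :
    pauliString P * pauliString Q = sgn (sympl P Q) • (pauliString Q * pauliString P) := by
  ext x y
  simp [pauliString_mul_apply, sympl, sgn_sum, pauliMatrix_comm (P _) (Q _),
    Finset.prod_mul_distrib]
  rfl

theorem pauliString_zero [DecidableEq a] : pauliString (0 : a → Pauli) = 1 := by
  ext x y
  simp only [pauliString, Pi.zero_apply, pauliMatrix_zero, Matrix.one_apply, Finset.prod_ite_zero,
    Finset.prod_const_one, Finset.mem_univ, true_imp_iff, funext_iff]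

theorem pauliString_mul_self [DecidableEq a] (P : a → Pauli) :
    pauliString P * pauliString P ∝ 1 := by
  have := pauliString_mul P P
  rwa [zmod_two_add_self, pauliString_zero] at this

/-- A Pauli string is invertible, being its own inverse up to a scalar. -/
theorem pauliString_mul_ne_zero [DecidableEq a] {r : Type} (P : a → Pauli)
    (A : Matrix (a → ZMod 2) r ℂ) : pauliString P * A ≠ 0 ↔ A ≠ 0 := by
  refine ⟨fun h h0 => h (by rw [h0, Matrix.mul_zero]), fun h h0 => h ?_⟩
  have h1 := (pauliString_mul_self P).mul_right A
  rw [Matrix.mul_assoc, h0, Matrix.mul_zero, Matrix.one_mul] at h1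
  by_contra h2
  exact (h1.ne_zero_iff.2 h2) rfl

theorem pauliString_comp_equiv {a' : Type} [Fintype a'] (e : a ≃ a') (P : a' → Pauli) :
    pauliString (fun j => P (e j)) =
      (pauliString P).submatrix (fun x j => x (e.symm j)) (fun x j => x (e.symm j)) := by
  ext x y
  simp only [pauliString, Matrix.submatrix_apply]
  exact Fintype.prod_equiv e _ _ fun j => by simp

end PauliString

/-! ### Measurement projectors -/

section Measurement

variable {a : Type} [Fintype a]

/-- The projector that belongs to the outcome `m` of the measurement of the Pauli string `P`. -/
def measMap [DecidableEq a] (P : a → Pauli) (m : ZMod 2) : QMap a a :=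
  (1 / 2 : ℂ) • (1 + sgn m • pauliString P)

/-- An anticommuting Pauli changes the sign in the projector, which is the same as flipping the
outcome. -/
theorem measMap_mul_pauliString [DecidableEq a] (P R : a → Pauli) (m : ZMod 2) :
    measMap P m * pauliString R = pauliString R * measMap P (m + sympl P R) := by
  simp only [measMap, Matrix.smul_mul, Matrix.mul_smul, Matrix.add_mul, Matrix.mul_add,
    Matrix.one_mul, Matrix.mul_one, sgn_add]
  rw [pauliString_comm P R, smul_smul]

end Measurement

/-! ### Entries of Pauli strings -/

section Entries

variable {a : Type} [Fintype a]

/-- The phase of a Pauli string. -/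
def stringPhase (P : a → Pauli) : ℂ := ∏ j, pauliPhase (P j)

theorem stringPhase_ne_zero (P : a → Pauli) : stringPhase P ≠ 0 :=
  Finset.prod_ne_zero_iff.2 fun j _ => pauliPhase_ne_zero (P j)

/-- The bit flips of a Pauli string. -/
def xPart (P : a → Pauli) : a → ZMod 2 := fun j => (P j).1

/-- The sign with which the phase flips of a Pauli string act on a basis vector. -/
def zSign (P : a → Pauli) (y : a → ZMod 2) : ℂ := sgn (∑ j, (P j).2 * y j)

theorem pauliString_apply [DecidableEq a] (P : a → Pauli) (x y : a → ZMod 2) :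
    pauliString P x y = if x = y + xPart P then stringPhase P * zSign P y else 0 := by
  simp only [pauliString, pauliMatrix_apply, Finset.prod_ite_zero, Finset.prod_mul_distrib,
    stringPhase, zSign, sgn_sum, Finset.mem_univ, true_imp_iff, funext_iff, Pi.add_apply, xPart]

theorem mul_pauliString_entry [DecidableEq a] {r : Type} (A : Matrix r (a → ZMod 2) ℂ)
    (Q : a → Pauli) (x : r) (y : a → ZMod 2) :
    (A * pauliString Q) x y = stringPhase Q * (A x (y + xPart Q) * zSign Q y) := by
  simp only [Matrix.mul_apply, pauliString_apply, mul_ite, mul_zero, Finset.sum_ite_eq',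
    Finset.mem_univ, if_true]
  ring

theorem pauliString_mul_entry [DecidableEq a] {r : Type} (A : Matrix (a → ZMod 2) r ℂ)
    (E : a → Pauli) (x : a → ZMod 2) (y : r) :
    (pauliString E * A) x y = stringPhase E * (zSign E (x + xPart E) * A (x + xPart E) y) := by
  have h (w : a → ZMod 2) : x = w + xPart E ↔ w = x + xPart E := by
    constructor <;> rintro rfl <;> rw [add_assoc, zmod_two_add_self, add_zero]
  simp only [Matrix.mul_apply, pauliString_apply, ite_mul, zero_mul, h, Finset.sum_ite_eq',
    Finset.mem_univ, if_true]
  ring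

/-- Reduces the conjugation of Paulis by a gate to a sign identity between matrix entries; the
phases of the strings are constants and go into the scalar. -/
theorem intertwine_of_entries {b : Type} [Fintype b] [DecidableEq a] [DecidableEq b]
    {A : QMap a b} {Q : a → Pauli} {E : b → Pauli} {z : ℂ} (hz : z ≠ 0)
    (h : ∀ x y, A x (y + xPart Q) * zSign Q y = z * (zSign E (x + xPart E) * A (x + xPart E) y)) :
    A * pauliString Q ∝ pauliString E * A := by
  refine ⟨stringPhase Q * z * (stringPhase E)⁻¹, ?_, ?_⟩
  · simp [stringPhase_ne_zero, hz]
  · ext x y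
    rw [mul_pauliString_entry, h, Matrix.smul_apply, pauliString_mul_entry, smul_eq_mul]
    have := stringPhase_ne_zero E
    field_simp

end Entries

/-! ### Propagation of faults -/

theorem Gate.hadamard_apply (x y : Fin 1 → ZMod 2) :
    Gate.hadamard.toMap x y = (((Real.sqrt 2)⁻¹ : ℝ) : ℂ) * sgn (x 0 * y 0) := by
  have h (s t : ZMod 2) : (s = 1 ∧ t = 1) ↔ s * t = 1 := by revert s t; decide
  simp only [Gate.toMap, sgn, h]

theorem Gate.phase_apply (x y : Fin 1 → ZMod 2) :
    Gate.phase.toMap x y = if x 0 = y 0 then (if y 0 = 1 then Complex.I else 1) else 0 := by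
  simp only [Gate.toMap, funext_iff, Fin.forall_fin_one]

/-- Clifford gates normalise the Pauli group: Hadamard swaps the two components, `S` adds the `X`
part to the `Z` part, and CNOT copies `X` from control to target and `Z` from target to control. -/
theorem Gate.intertwine {a b : Type} (g : Gate a b) [ia : Fintype a] [ib : Fintype b]
    [da : DecidableEq a] [db : DecidableEq b] (Q : a → Pauli) :
    ∃ E : b → Pauli, g.toMap * pauliString Q ∝ pauliString E * g.toMap := by
  -- Preparations have no input wires, so the Pauli on their inputs is trivial.
  have key : ∀ (a' : Type) [Fintype a'] [DecidableEq a'] [IsEmpty a'] (A : QMap a' b)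
      (Q : a' → Pauli), ∃ E : b → Pauli, A * pauliString Q ∝ pauliString E * A := by
    intro a' _ _ _ A Q
    refine ⟨0, .of_eq ?_⟩
    rw [pauliString_zero, Matrix.one_mul, Subsingleton.elim Q 0, pauliString_zero, Matrix.mul_one]
  cases g with
  | zero => exact key _ _ _
  | cat B n => exact key _ _ _
  | hadamard =>
    refine ⟨fun j => ((Q j).2, (Q j).1), ?_⟩
    obtain rfl : ia = Fin.fintype 1 := Subsingleton.elim _ _
    obtain rfl : ib = Fin.fintype 1 := Subsingleton.elim _ _
    obtain rfl : da = db := Subsingleton.elim _ _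
    refine intertwine_of_entries (sgn_ne_zero ((Q 0).1 * (Q 0).2)) fun x y => ?_
    have h (x y p q : ZMod 2) (r : ℂ) : r * sgn (x * (y + p)) * sgn (q * y) =
        sgn (p * q) * (sgn (p * (x + q)) * (r * sgn ((x + q) * y))) := by
      simp only [mul_add, add_mul, sgn_add, mul_comm x p]
      linear_combination (-(r * sgn (q * y) * sgn (x * y) * sgn (p * x))) * sgn_mul_self (p * q)
    rw [hadamard_apply, hadamard_apply, zSign, zSign, Fin.sum_univ_one, Fin.sum_univ_one]
    exact h (x 0) (y 0) (Q 0).1 (Q 0).2 _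
  | phase =>
    refine ⟨fun j => ((Q j).1, (Q j).2 + (Q j).1), ?_⟩
    obtain rfl : ia = Fin.fintype 1 := Subsingleton.elim _ _
    obtain rfl : ib = Fin.fintype 1 := Subsingleton.elim _ _
    obtain rfl : da = db := Subsingleton.elim _ _
    -- The scalar comes from `S X = i X Z S`.
    have hz : (if (Q 0).1 = 1 then Complex.I else 1) ≠ 0 := by split_ifs <;> simp
    refine intertwine_of_entries hz fun x y => ?_
    have h (x y p q : ZMod 2) :
        (if x = y + p then (if y + p = 1 then Complex.I else 1) else 0) * sgn (q * y) =
          (if p = 1 then Complex.I else 1) * (sgn ((q + p) * (x + p)) *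
            (if x + p = y then (if y = 1 then Complex.I else 1) else 0)) := by
      rcases zmod_two_cases x with rfl | rfl <;> rcases zmod_two_cases y with rfl | rfl <;>
        rcases zmod_two_cases p with rfl | rfl <;> rcases zmod_two_cases q with rfl | rfl <;>
        simp [zmod_two_add_self]
    rw [phase_apply, phase_apply, zSign, zSign, Fin.sum_univ_one, Fin.sum_univ_one]
    exact h (x 0) (y 0) (Q 0).1 (Q 0).2
  | cnot =>
    refine ⟨![((Q 0).1, (Q 0).2 + (Q 1).2), ((Q 1).1 + (Q 0).1, (Q 1).2)], ?_⟩
    obtain rfl : ia = Fin.fintype 2 := Subsingleton.elim _ _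
    obtain rfl : ib = Fin.fintype 2 := Subsingleton.elim _ _
    obtain rfl : da = db := Subsingleton.elim _ _
    refine intertwine_of_entries one_ne_zero fun x y => ?_
    have h (x x' y y' p p' q q' : ZMod 2) :
        (if x = y + p ∧ x' = y' + p' + (y + p) then 1 else 0) * sgn (q * y + q' * y') =
          1 * (sgn ((q + q') * (x + p) + q' * (x' + (p' + p))) *
            (if x + p = y ∧ x' + (p' + p) = y' + y then 1 else 0)) := by
      have h : (x = y + p ∧ x' = y' + p' + (y + p)) ↔ (x + p = y ∧ x' + (p' + p) = y' + y) := by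
        revert x x' y y' p p'
        decide
      simp only [h]
      split_ifs with h'
      · rw [h'.1, h'.2, one_mul, one_mul, mul_one]
        congr 1
        linear_combination -(zmod_two_add_self (q' * y))
      · simp
    rw [zSign, zSign, Fin.sum_univ_two, Fin.sum_univ_two]
    exact h (x 0) (x 1) (y 0) (y 1) (Q 0).1 (Q 1).1 (Q 0).2 (Q 1).2

theorem submatrix_mul_relabel {b b' r s r' s' : Type} [Fintype b] [Fintype b'] [DecidableEq b]
    [DecidableEq b'] (e : b ≃ b') (A : Matrix r (b → ZMod 2) ℂ) (A' : Matrix (b → ZMod 2) s ℂ)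
    (f : r' → r) (g : s' → s) :
    (A * A').submatrix f g =
      A.submatrix f (fun (x : b' → ZMod 2) j => x (e j)) *
        A'.submatrix (fun (x : b' → ZMod 2) j => x (e j)) g := by
  ext x y
  simp only [Matrix.submatrix_apply, Matrix.mul_apply]
  exact (Fintype.sum_equiv ((Equiv.arrowCongr e (Equiv.refl (ZMod 2))).symm) _ _
    fun w => rfl).symm

namespace ParityForm

variable {o o' : Type}

/-- The linear part of a parity. -/
def linear (f : ParityForm o) (k : o → ZMod 2) : ZMod 2 := (f.terms.map k).sum

theorem eval_add (f : ParityForm o) (k s : o → ZMod 2) :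
    f.eval (k + s) = f.eval k + f.linear s := by
  simp [eval, linear, Multiset.sum_map_add, add_assoc]

theorem eval_map (g : o → o') (f : ParityForm o) (k : o' → ZMod 2) :
    (f.map g).eval k = f.eval fun v => k (g v) := by
  simp [eval, map]

theorem eval_xor (f g : ParityForm o) (k : o → ZMod 2) :
    (f.xor g).eval k = f.eval k + g.eval k := by
  simp only [eval, xor, Multiset.map_add, Multiset.sum_add]
  abel

theorem eval_single (v : o) (k : o → ZMod 2) : (single v).eval k = k v := by
  simp [eval, single]

end ParityForm

namespace Circuit

theorem sem_wires_zero {c a : Type} [Fintype a] [DecidableEq a] (κ : c → ZMod 2)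
    (k : Empty → ZMod 2) : (wires : Circuit c Empty a a).sem 0 κ k = 1 :=
  pauliString_zero

/-- `sem` is built with classical decidability; this and the following lemmas restate it for
arbitrary instances. -/
theorem sem_gate {c a b : Type} [Fintype b] [DecidableEq b] (noisy : Bool) (g : Gate a b)
    (F : b → Pauli) (κ : c → ZMod 2) (k : Empty → ZMod 2) :
    (gate noisy g : Circuit c Empty a b).sem F κ k = pauliString F * g.toMap := by
  simp only [sem]
  congr!

theorem sem_gate_zero {c a b : Type} [Fintype b] (noisy : Bool) (g : Gate a b)
    (κ : c → ZMod 2) (k : Empty → ZMod 2) :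
    (gate noisy g : Circuit c Empty a b).sem 0 κ k = g.toMap := by
  classical
  exact (sem_gate noisy g 0 κ k).trans (by rw [pauliString_zero, Matrix.one_mul])

theorem sem_measure {c a : Type} [Fintype a] [DecidableEq a] (N : MeasNoise) (P : a → Pauli)
    (F : a ⊕ a → Pauli) (κ : c → ZMod 2) (k : Unit → ZMod 2) :
    (measure N P : Circuit c Unit a a).sem F κ k =
      pauliString (fun j => F (.inr j)) * measMap P (k ()) * pauliString fun j => F (.inl j) := by
  simp only [sem, measMap, sgn]
  congr!

theorem sem_measure_zero {c a : Type} [Fintype a] [DecidableEq a] (N : MeasNoise) (P : a → Pauli)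
    (κ : c → ZMod 2) (k : Unit → ZMod 2) :
    (measure N P : Circuit c Unit a a).sem 0 κ k = measMap P (k ()) := by
  refine (sem_measure N P 0 κ k).trans ?_
  have h : pauliString (fun _ : a => (0 : Pauli)) = 1 := pauliString_zero
  simp [h]

theorem sem_destroy_zero {c : Type} (noisy : Bool) (κ : c → ZMod 2) (k : Unit → ZMod 2)
    (x : Fin 0 → ZMod 2) (y : Fin 1 → ZMod 2) :
    (destroy noisy : Circuit c Unit (Fin 1) (Fin 0)).sem 0 κ k x y =
      if k () = y 0 then 1 else 0 := by
  change pauliMatrix 0 _ _ = _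
  rw [pauliMatrix_zero, Matrix.one_apply]

theorem sem_correct {c a : Type} [Fintype a] (P : a → Pauli) (f : a → ParityForm c)
    (F : (correct P f).Fault) (κ : c → ZMod 2) (k : Empty → ZMod 2) :
    (correct P f).sem F κ k = pauliString fun j => (f j).eval κ • P j := by
  simp only [sem]
  congr 1
  ext1 j
  rcases zmod_two_cases ((f j).eval κ) with h | h <;> simp [h]

theorem sem_seq {c o₁ o₂ a b d : Type} [Fintype b] [DecidableEq b] (C₁ : Circuit c o₁ a b)
    (C₂ : Circuit (c ⊕ o₁) o₂ b d) (F : (seq C₁ C₂).Fault) (κ : c → ZMod 2)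
    (k : o₁ ⊕ o₂ → ZMod 2) :
    (seq C₁ C₂).sem F κ k =
      C₂.sem (fun l => F (.inr l)) (Sum.elim κ fun v => k (.inl v)) (fun v => k (.inr v)) *
        C₁.sem (fun l => F (.inl l)) κ fun v => k (.inl v) := by
  simp only [sem]
  congr!

theorem sem_par {c ι : Type} [Fintype ι] {o a b : ι → Type} (C : ∀ i, Circuit c (o i) (a i) (b i))
    (F : (par C).Fault) (κ : c → ZMod 2) (k : (Σ i, o i) → ZMod 2) :
    (par C).sem F κ k = kron fun i => (C i).sem (fun l => F ⟨i, l⟩) κ fun v => k ⟨i, v⟩ := rfl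

theorem sem_relabel {c o a b c' o' a' b' : Type} (fc : c → c') (eo : o ≃ o') (ea : a ≃ a')
    (eb : b ≃ b') (C : Circuit c o a b) (F : (relabel fc eo ea eb C).Fault)
    (κ : c' → ZMod 2) (k : o' → ZMod 2) :
    (relabel fc eo ea eb C).sem F κ k =
      (C.sem F (fun v => κ (fc v)) fun v => k (eo v)).submatrix
        (fun (x : b' → ZMod 2) j => x (eb j)) fun (x : a' → ZMod 2) j => x (ea j) := rfl

/-- The faults of a stabiliser circuit, a Pauli string on its inputs and flips of its controls
amount to flips of its outcomes and a Pauli string on its outputs. -/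
theorem exists_propagation {c o a b : Type} (C : Circuit c o a b) :
    ∀ [Fintype a] [Fintype b] [DecidableEq a] [DecidableEq b] (F : C.Fault) (Q : a → Pauli)
      (τ : c → ZMod 2), ∃ (E : b → Pauli) (s : o → ZMod 2), ∀ κ k,
        C.sem F (κ + τ) k * pauliString Q ∝ pauliString E * C.sem 0 κ (k + s) := by
  induction C with
  | @wires c a iw =>
    intro ia ib da db F Q τ
    -- The constructor stores its own finiteness instance, which has to be identified with the
    -- ambient ones.
    obtain rfl : iw = ia := Subsingleton.elim _ _
    obtain rfl : iw = ib := Subsingleton.elim _ _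
    obtain rfl : da = db := Subsingleton.elim _ _
    change a → Pauli at F
    refine ⟨F + Q, 0, fun κ k => ?_⟩
    rw [sem_wires_zero, Matrix.mul_one]
    exact pauliString_mul F Q
  | @gate c a b ib noisy g =>
    intro _ ib' _ _ F Q τ
    obtain rfl : ib = ib' := Subsingleton.elim _ _
    change b → Pauli at F
    obtain ⟨E, hE⟩ := g.intertwine Q
    refine ⟨F + E, 0, fun κ k => ?_⟩
    rw [sem_gate_zero]
    refine (ScalarEq.of_eq (congrArg (· * _) (sem_gate noisy g F _ k))).trans ?_
    rw [Matrix.mul_assoc]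
    refine (hE.mul_left _).trans ?_
    rw [← Matrix.mul_assoc]
    exact (pauliString_mul _ _).mul_right _
  | @measure c a iw N P =>
    intro ia ib da db F Q τ
    obtain rfl : iw = ia := Subsingleton.elim _ _
    obtain rfl : iw = ib := Subsingleton.elim _ _
    obtain rfl : da = db := Subsingleton.elim _ _
    change a ⊕ a → Pauli at F
    let R : a → Pauli := (fun j => F (.inl j)) + Q
    -- Everything before the measurement, `R`, passes to the output and flips the outcome exactly if
    -- it anticommutes with `P`.
    refine ⟨(fun j => F (.inr j)) + R, fun _ => sympl P R, fun κ k => ?_⟩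
    rw [sem_measure_zero]
    refine (ScalarEq.of_eq (congrArg (· * _) (sem_measure N P F _ k))).trans ?_
    rw [Matrix.mul_assoc]
    refine ((pauliString_mul _ _).mul_left _).trans ?_
    rw [Matrix.mul_assoc, measMap_mul_pauliString, ← Matrix.mul_assoc]
    exact (pauliString_mul _ _).mul_right _
  | destroy noisy =>
    intro ia ib _ _ F Q τ
    obtain rfl : ia = Fin.fintype 1 := Subsingleton.elim _ _
    change Fin 1 → Pauli at F
    -- No output wire is left: the `X` parts flip the outcome and the `Z` parts only contribute a
    -- sign.
    refine ⟨0, fun _ => (F 0).1 + (Q 0).1, fun κ k => ?_⟩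
    rw [pauliString_zero, Matrix.one_mul]
    refine ⟨stringPhase Q * pauliPhase (F 0) * sgn ((F 0).2 * (k () + (F 0).1)) *
      sgn ((Q 0).2 * (k () + ((F 0).1 + (Q 0).1))),
      by simp [stringPhase_ne_zero, pauliPhase_ne_zero, sgn_ne_zero], ?_⟩
    ext x y
    rw [mul_pauliString_entry, Matrix.smul_apply, smul_eq_mul, sem_destroy_zero]
    have h (p q s t : ZMod 2) (h : s + (p + q) = t) : s = t + q + p ∧ t + q = s + p := by
      revert p q s t; decide
    have h' (p q s t : ZMod 2) (h : s = t + q + p) : s + (p + q) = t := by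
      revert p q s t; decide
    change _ * (pauliMatrix (F 0) (k ()) (y 0 + (Q 0).1) * sgn (∑ j, (Q j).2 * y j)) =
      _ * if k () + ((F 0).1 + (Q 0).1) = y 0 then 1 else 0
    rw [pauliMatrix_apply, Fin.sum_univ_one]
    by_cases h1 : k () + ((F 0).1 + (Q 0).1) = y 0
    · rw [if_pos h1, if_pos (h _ _ _ _ h1).1, (h _ _ _ _ h1).2, h1]
      ring
    · rw [if_neg h1, if_neg fun h2 => h1 (h' _ _ _ _ h2)]
      simp
  | @correct c a iw P f =>
    intro ia ib da db F Q τ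
    obtain rfl : iw = ia := Subsingleton.elim _ _
    obtain rfl : iw = ib := Subsingleton.elim _ _
    obtain rfl : da = db := Subsingleton.elim _ _
    -- Flipped controls change the correction by a Pauli that depends only on the linear parts of
    -- the parities, not on `κ`.
    refine ⟨fun j => Q j + (f j).linear τ • P j, 0, fun κ k => ?_⟩
    rw [sem_correct, sem_correct]
    refine (pauliString_mul _ _).trans ((ScalarEq.of_eq (congrArg _ ?_)).trans
      (pauliString_mul _ _).symm)
    ext1 j
    simp only [Pi.add_apply, ParityForm.eval_add, add_smul]
    abel
  | @seq c o₁ o₂ a b d ib C₁ C₂ ih₁ ih₂ =>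
    intro _ _ _ _ F Q τ
    classical
    obtain ⟨E₁, s₁, h₁⟩ := ih₁ (fun l => F (Sum.inl l)) Q τ
    -- The output Pauli of the first circuit enters the second one, and its outcome flips `s₁`
    -- become control flips. This is why the induction allows an arbitrary `Q` and `τ`.
    obtain ⟨E₂, s₂, h₂⟩ := ih₂ (fun l => F (Sum.inr l)) E₁ (Sum.elim τ s₁)
    refine ⟨E₂, Sum.elim s₁ s₂, fun κ k => ?_⟩
    rw [sem_seq, sem_seq, Matrix.mul_assoc]
    refine ((h₁ κ _).mul_left _).trans ?_
    rw [← Matrix.mul_assoc, ← Matrix.mul_assoc]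
    refine ScalarEq.mul_right ?_ _
    -- The unshifted controls contain the outcomes `k + s₁`; adding the control flip `s₁` again
    -- gives back `k`.
    convert h₂ (Sum.elim κ fun v => (k + Sum.elim s₁ s₂) (.inl v)) (fun v => k (.inr v)) using 3
    · ext v
      cases v <;> simp [add_assoc, zmod_two_add_self]
    · rfl
    · rfl
  | @par c ι iι o a b C ih =>
    intro ia ib _ _ F Q τ
    classical
    -- The induction hypotheses need each component to have finitely many wires; these embed into
    -- the wires of the family.
    have (i : ι) : Fintype (a i) := Fintype.ofInjective (Sigma.mk i) sigma_mk_injective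
    have (i : ι) : Fintype (b i) := Fintype.ofInjective (Sigma.mk i) sigma_mk_injective
    choose E s h using fun i => ih i (fun l => F ⟨i, l⟩) (fun j => Q ⟨i, j⟩) τ
    refine ⟨fun j => E j.1 j.2, fun v => s v.1 v.2, fun κ k => ?_⟩
    obtain rfl : ia = Sigma.instFintype := Subsingleton.elim _ _
    obtain rfl : ib = Sigma.instFintype := Subsingleton.elim _ _
    rw [sem_par, sem_par, pauliString_sigma, pauliString_sigma, kron_mul, kron_mul]
    exact ScalarEq.kron fun i => h i κ fun v => k ⟨i, v⟩
  | @relabel c o a b c' o' a' b' fc eo ea eb C ih =>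
    intro _ _ _ _ F Q τ
    classical
    have : Fintype a := Fintype.ofEquiv _ ea.symm
    have : Fintype b := Fintype.ofEquiv _ eb.symm
    obtain ⟨E, s, h⟩ := ih F (fun j => Q (ea j)) fun v => τ (fc v)
    refine ⟨fun j => E (eb.symm j), fun v => s (eo.symm v), fun κ k => ?_⟩
    have h' := (h (fun v => κ (fc v)) fun v => k (eo v)).submatrix
      (fun (x : b' → ZMod 2) j => x (eb j)) (fun (x : a' → ZMod 2) j => x (ea j))
    rw [submatrix_mul_relabel ea, submatrix_mul_relabel eb] at h'
    have hQ := pauliString_comp_equiv ea.symm fun j => Q (ea j)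
    have hE := pauliString_comp_equiv eb.symm E
    simp only [Equiv.apply_symm_apply, Equiv.symm_symm] at hQ hE
    rw [hE, hQ]
    rw [sem_relabel, sem_relabel]
    convert h' using 4
    · rfl
    · refine congrArg (C.sem 0 _) (funext fun v => ?_)
      simp

end Circuit

/-! ### Weights -/

/-- `F` is a sum of `m` elements of `S`. -/
def SumOf {A : Type} [AddCommMonoid A] (S : Set A) (F : A) (m : ℕ) : Prop :=
  ∃ L : List A, (∀ G ∈ L, G ∈ S) ∧ L.sum = F ∧ L.length = m

namespace SumOf

variable {A : Type} [AddCommMonoid A] {S : Set A}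

protected theorem zero : SumOf S 0 0 := ⟨[], by simp⟩

theorem cons {G F : A} {m : ℕ} (hG : G ∈ S) (h : SumOf S F m) : SumOf S (G + F) (m + 1) := by
  obtain ⟨L, hL, rfl, rfl⟩ := h
  exact ⟨G :: L, by simpa using ⟨hG, hL⟩, by simp, by simp⟩

theorem induction (p : A → ℕ → Prop) (h0 : p 0 0)
    (h1 : ∀ G F m, G ∈ S → p F m → p (G + F) (m + 1)) {F : A} {m : ℕ}
    (h : SumOf S F m) : p F m := by
  obtain ⟨L, hL, rfl, rfl⟩ := h
  induction L with
  | nil => exact h0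
  | cons G L ih =>
    rw [List.sum_cons, List.length_cons]
    exact h1 _ _ _ (hL G (by simp)) (ih fun G' h => hL G' (by simp [h]))

theorem eq_zero {F : A} (h : SumOf S F 0) : F = 0 := by
  obtain ⟨L, -, rfl, h⟩ := h
  simp [List.length_eq_zero_iff.1 h]

theorem add {F G : A} {m m' : ℕ} (h : SumOf S F m) (h' : SumOf S G m') :
    SumOf S (F + G) (m + m') := by
  obtain ⟨L, hL, rfl, rfl⟩ := h
  obtain ⟨L', hL', rfl, rfl⟩ := h'
  exact ⟨L ++ L', fun G h => (List.mem_append.1 h).elim (hL G) (hL' G), by simp, by simp⟩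

end SumOf

namespace Circuit

/-- The fault `F` is a sum of `m` atomic faults. -/
abbrev GenBy {c o a b : Type} (C : Circuit c o a b) (F : C.Fault) (m : ℕ) : Prop :=
  SumOf C.atoms F m

section

variable {c o a b : Type} {C : Circuit c o a b}

theorem GenBy.mem_faultGroup {F : C.Fault} {m : ℕ} (h : C.GenBy F m) : F ∈ C.faultGroup :=
  SumOf.induction (fun F _ => F ∈ C.faultGroup) (zero_mem _) (fun _ _ _ hG hF =>
    add_mem (AddSubgroup.subset_closure hG) hF) h

theorem GenBy.wt_le {F : C.Fault} {m : ℕ} (h : C.GenBy F m) : C.wt F ≤ m := Nat.sInf_le h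

theorem fault_neg (F : C.Fault) : -F = F := ZModModule.neg_eq_self F

/-- Faults are their own negatives, so the generated group consists of sums of atomic faults and the
infimum is attained rather than being the default value `0` of an empty set. -/
theorem genBy_wt {F : C.Fault} (h : F ∈ C.faultGroup) : C.GenBy F (C.wt F) := by
  have : ∃ m, C.GenBy F m := by
    induction h using AddSubgroup.closure_induction with
    | mem G hG => exact ⟨_, add_zero G ▸ SumOf.zero.cons hG⟩
    | zero => exact ⟨0, SumOf.zero⟩
    | add F G _ _ hF hG =>
      obtain ⟨m, hF⟩ := hF
      obtain ⟨m', hG⟩ := hG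
      exact ⟨_, hF.add hG⟩
    | neg F _ hF => rwa [fault_neg]
  exact Nat.sInf_mem this

end

/-- Every atomic fault of a composition lies in one factor, so a generating list splits and its
length is additive. -/
theorem GenBy.seq {c o₁ o₂ a b d : Type} [Fintype b] {C₁ : Circuit c o₁ a b}
    {C₂ : Circuit (c ⊕ o₁) o₂ b d} {F : (seq C₁ C₂).Fault} {m : ℕ} (h : (seq C₁ C₂).GenBy F m) :
    ∃ m₁ m₂, m₁ + m₂ = m ∧ C₁.GenBy (fun l => F (.inl l)) m₁ ∧
      C₂.GenBy (fun l => F (.inr l)) m₂ := by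
  refine SumOf.induction (fun F m => ∃ m₁ m₂, m₁ + m₂ = m ∧ C₁.GenBy (fun l => F (.inl l)) m₁ ∧
      C₂.GenBy (fun l => F (.inr l)) m₂) ⟨0, 0, rfl, SumOf.zero, SumOf.zero⟩ ?_ h
  rintro _ F m (⟨G, hG, rfl⟩ | ⟨G, hG, rfl⟩) ⟨m₁, m₂, rfl, h₁, h₂⟩
  · refine ⟨m₁ + 1, m₂, by ring, h₁.cons hG, ?_⟩
    convert h₂ using 1
    exact funext fun l => zero_add (F (.inr l))
  · refine ⟨m₁, m₂ + 1, by ring, ?_, h₂.cons hG⟩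
    convert h₁ using 1
    exact funext fun l => zero_add (F (.inl l))

theorem GenBy.seq_right {c o₁ o₂ a b d : Type} [Fintype b] (C₁ : Circuit c o₁ a b)
    {C₂ : Circuit (c ⊕ o₁) o₂ b d} {F : C₂.Fault} {m : ℕ} (h : C₂.GenBy F m) :
    (Circuit.seq C₁ C₂).GenBy (Sum.elim (fun _ => 0) F) m := by
  refine SumOf.induction (fun F m => (Circuit.seq C₁ C₂).GenBy (Sum.elim (fun _ => 0) F) m)
    ?_ ?_ h
  · have h0 : (Sum.elim (fun _ => 0) 0 : (Circuit.seq C₁ C₂).Fault) = 0 :=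
      funext fun l => by cases l <;> rfl
    exact h0 ▸ SumOf.zero
  · intro G F m hG hF
    have h1 : (Sum.elim (fun _ => 0) (G + F) : (Circuit.seq C₁ C₂).Fault) =
        (Sum.elim (fun _ => 0) G : (Circuit.seq C₁ C₂).Fault) + Sum.elim (fun _ => 0) F :=
      funext fun l => by
        cases l
        · exact (zero_add (0 : Pauli)).symm
        · rfl
    exact h1 ▸ hF.cons (Or.inr ⟨G, hG, rfl⟩)

theorem GenBy.par {c ι : Type} [Fintype ι] {o a b : ι → Type}
    {C : ∀ i, Circuit c (o i) (a i) (b i)} {F : (par C).Fault} {m : ℕ} (h : (par C).GenBy F m) :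
    ∃ μ : ι → ℕ, ∑ i, μ i = m ∧ ∀ i, (C i).GenBy (fun l => F ⟨i, l⟩) (μ i) := by
  classical
  refine SumOf.induction (fun F m => ∃ μ : ι → ℕ, ∑ i, μ i = m ∧
    ∀ i, (C i).GenBy (fun l => F ⟨i, l⟩) (μ i)) ⟨0, by simp, fun i => SumOf.zero⟩ ?_ h
  rintro G F m ⟨i, hi, hG⟩ ⟨μ, rfl, h⟩
  refine ⟨μ + Pi.single i 1, by simp [Finset.sum_add_distrib], fun j => ?_⟩
  by_cases hj : j = i
  · subst hj
    have hj : (μ + Pi.single j 1 : ι → ℕ) j = μ j + 1 := by simp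
    rw [hj]
    exact (h j).cons hi
  · convert h j using 1
    · exact funext fun l => (congrArg (· + F ⟨j, l⟩) (hG j hj l)).trans (zero_add (F ⟨j, l⟩))
    · simp [hj]

end Circuit

/-! ### Numbers of flipped wires -/

/-- The component of a Pauli along `B.flip`. -/
def CatBasis.flipPart (B : CatBasis) : Pauli →+ ZMod 2 :=
  match B with
  | .Z => AddMonoidHom.fst _ _
  | .X => AddMonoidHom.snd _ _

/-- The component of a Pauli along `B.check`. -/
def CatBasis.checkPart (B : CatBasis) : Pauli →+ ZMod 2 :=
  match B with
  | .Z => AddMonoidHom.snd _ _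
  | .X => AddMonoidHom.fst _ _

theorem CatBasis.symp_check (B : CatBasis) (p : Pauli) : symp B.check p = B.flipPart p := by
  cases B <;> simp [symp, check, flipPart]

@[simp] theorem CatBasis.flipPart_flip (B : CatBasis) : B.flipPart B.flip = 1 := by
  cases B <;> rfl

@[simp] theorem CatBasis.checkPart_flip (B : CatBasis) : B.checkPart B.flip = 0 := by
  cases B <;> rfl

@[simp] theorem CatBasis.flipPart_check (B : CatBasis) : B.flipPart B.check = 0 := by
  cases B <;> rfl

@[simp] theorem CatBasis.checkPart_check (B : CatBasis) : B.checkPart B.check = 1 := by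
  cases B <;> rfl

section FlipWeight

variable {a : Type} [Fintype a]

/-- The number of wires on which a Pauli string exchanges the vectors of the basis `B`. -/
def flipWeight (B : CatBasis) (P : a → Pauli) : ℕ := {j | B.flipPart (P j) ≠ 0}.ncard

theorem flipWeight_eq_sum (B : CatBasis) (P : a → Pauli) :
    flipWeight B P = ∑ j, (B.flipPart (P j)).val := by
  classical
  rw [flipWeight, Set.ncard_eq_toFinset_card', Set.toFinset_ofPred, Finset.card_filter]
  refine Finset.sum_congr rfl fun j _ => ?_
  generalize B.flipPart (P j) = s
  revert s; decide

theorem flipWeight_add_le (B : CatBasis) (P Q : a → Pauli) :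
    flipWeight B (P + Q) ≤ flipWeight B P + flipWeight B Q := by
  rw [flipWeight_eq_sum, flipWeight_eq_sum, flipWeight_eq_sum, ← Finset.sum_add_distrib]
  refine Finset.sum_le_sum fun j _ => ?_
  rw [Pi.add_apply, map_add]
  exact ZMod.val_add_le _ _

@[simp] theorem flipWeight_zero (B : CatBasis) : flipWeight B (0 : a → Pauli) = 0 := by
  simp [flipWeight_eq_sum]

theorem IsSingleFlip.flipWeight_le {P : a → Pauli} (h : IsSingleFlip P) (B : CatBasis) :
    flipWeight B P ≤ 1 := by
  obtain ⟨j, -, hj⟩ := h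
  rw [flipWeight_eq_sum, Finset.sum_eq_single j (fun j' _ h => by simp [hj j' h]) (by simp)]
  have := ZMod.val_lt (B.flipPart (P j))
  omega

theorem SumOf.flipWeight_le {P : a → Pauli} {m : ℕ} (h : SumOf {P | IsSingleFlip P} P m)
    (B : CatBasis) : flipWeight B P ≤ m := by
  refine SumOf.induction (fun P m => flipWeight B P ≤ m) (flipWeight_zero B).le ?_ h
  intro G F m hG hF
  have := flipWeight_add_le B G F
  have := IsSingleFlip.flipWeight_le hG B
  omega

theorem Circuit.GenBy.of_wires {c : Type} {F : (wires : Circuit c Empty a a).Fault} {m : ℕ}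
    (h : (wires : Circuit c Empty a a).GenBy F m) :
    SumOf {P : a → Pauli | IsSingleFlip P} F m := h

/-- One atomic fault for each wire on which the string is non-trivial. -/
theorem sumOf_singleFlips (P : a → Pauli) : SumOf {P | IsSingleFlip P} P {j | P j ≠ 0}.ncard := by
  classical
  refine ⟨(Finset.univ.filter fun j => P j ≠ 0).toList.map fun j => Pi.single j (P j), ?_, ?_, ?_⟩
  · intro G hG
    obtain ⟨j, hj, rfl⟩ := List.mem_map.1 hG
    exact ⟨j, by simpa using hj, fun j' h => by simp [h]⟩
  · rw [Finset.sum_map_toList]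
    ext1 j
    rw [Finset.sum_apply]
    simp only [Finset.sum_pi_single]
    simp [eq_comm]
  · rw [List.length_map, Finset.length_toList, Set.ncard_eq_toFinset_card']
    simp

end FlipWeight

/-! ### Faults on the idealised specifications -/

open Circuit

/-- The cat state. -/
abbrev catMap (B : CatBasis) (n : ℕ) : QMap (Fin 0) (Fin n) := (Gate.cat B n).toMap

theorem genBy_idealCat {B : CatBasis} {n m : ℕ} {G : (idealCat B n).circuit.Fault}
    (h : (idealCat B n).circuit.GenBy G m) :
    ∃ (P : Fin n → Pauli) (m' : ℕ), m' ≤ m ∧ SumOf {P | IsSingleFlip P} P m' ∧ ∀ κ k,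
      (idealCat B n).circuit.sem G κ k = pauliString P * catMap B n := by
  obtain ⟨m₁, m₂, rfl, h₁, h₂⟩ := GenBy.seq h
  refine ⟨fun j => G (.inr j), m₂, Nat.le_add_left _ _, h₂.of_wires,
    fun κ k => ?_⟩
  -- The fault-free preparation has no atomic faults.
  have hG : (fun l => G (.inl l)) = 0 := by
    refine SumOf.induction (fun F _ => F = 0) rfl (fun _ _ _ h => ?_) h₁
    have h : false = true := h.1
    contradiction
  refine (sem_seq _ _ _ _ _).trans ?_
  rw [hG, sem_gate_zero]
  rfl

/-- The faults of an idealised fault-tolerant measurement. -/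
def measAtoms (B : CatBasis) : Set (Fin 2 ⊕ Fin 2 → Pauli) :=
  {F | ∃ Q R : Fin 2 → Pauli, Anticommute (fun _ => B.check) Q ∧ (R = 0 ∨ IsSingleFlip R) ∧
    F = Sum.elim Q (Q + R)}

theorem Circuit.GenBy.of_measure {c : Type} {B : CatBasis} {m : ℕ}
    {F : (measure .faultTolerant fun _ => B.check : Circuit c Unit (Fin 2) (Fin 2)).Fault}
    (h : (measure .faultTolerant fun _ => B.check : Circuit c Unit (Fin 2) (Fin 2)).GenBy F m) :
    SumOf (measAtoms B) F m := h

/-- The anticommuting Pauli occurs before and after the measurement and cancels in the product, so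
each atomic fault leaves at most one flipped output. -/
theorem SumOf.flipWeight_measAtoms {B : CatBasis} {F : Fin 2 ⊕ Fin 2 → Pauli} {m : ℕ}
    (h : SumOf (measAtoms B) F m) :
    flipWeight B ((fun j => F (.inr j)) + fun j => F (.inl j)) ≤ m := by
  let p (F : Fin 2 ⊕ Fin 2 → Pauli) (m : ℕ) : Prop :=
    flipWeight B ((fun j => F (.inr j)) + fun j => F (.inl j)) ≤ m
  have h0 : p 0 0 := by simp [p, flipWeight_eq_sum]
  refine SumOf.induction p h0 ?_ h
  intro G F m hG hF
  obtain ⟨Q, R, -, hR, hG⟩ := hG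
  have hR : flipWeight B R ≤ 1 := by
    rcases hR with hR | hR
    · rw [hR, flipWeight_zero]; exact Nat.zero_le 1
    · exact hR.flipWeight_le B
  have h1 : ((fun j => (G + F) (.inr j)) + fun j => (G + F) (.inl j) : Fin 2 → Pauli) =
      R + ((fun j => F (.inr j)) + fun j => F (.inl j)) := by
    ext1 j
    simp only [hG, Pi.add_apply, Sum.elim_inl, Sum.elim_inr]
    linear_combination zmod_two_add_self (Q j)
  change flipWeight B _ ≤ _
  rw [h1]
  exact (flipWeight_add_le B R _).trans (by omega)

/-- The Pauli string on the outputs that results from faults before (`S`), directly before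
(`Q`), directly after (`T`) and after (`U`) a measurement. -/
theorem sem_idealCheck (B : CatBasis) (G : (idealCheck B).circuit.Fault) (S Q T U : Fin 2 → Pauli)
    (hS : S = fun j => G (.inl j)) (hQ : Q = fun j => G (.inr (.inl (.inl j))))
    (hT : T = fun j => G (.inr (.inl (.inr j)))) (hU : U = fun j => G (.inr (.inr j)))
    (κ : Empty → ZMod 2) (k : (idealCheck B).Outcome → ZMod 2) :
    (idealCheck B).circuit.sem G κ k ∝ pauliString (U + (T + (Q + S))) *
      measMap (fun _ : Fin 2 => B.check) (k (.inr (.inl ())) + sympl (fun _ => B.check) (Q + S)) := by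
  have h : (idealCheck B).circuit.sem G κ k = pauliString U *
      (pauliString T * measMap (fun _ : Fin 2 => B.check) (k (.inr (.inl ()))) * pauliString Q) *
        pauliString S := by
    subst hS hQ hT hU
    refine (sem_seq _ _ _ _ _).trans ?_
    rw [sem_seq]
    refine congrArg (· * _) (congrArg (_ * ·) ?_)
    exact sem_measure _ _ _ _ _
  rw [h, Matrix.mul_assoc, Matrix.mul_assoc]
  refine (((pauliString_mul _ _).mul_left _).mul_left _).trans ?_
  rw [Matrix.mul_assoc, measMap_mul_pauliString, ← Matrix.mul_assoc, ← Matrix.mul_assoc,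
    Matrix.mul_assoc (pauliString _)]
  refine ScalarEq.mul_right ?_ _
  exact ((pauliString_mul _ _).mul_left _).trans (pauliString_mul _ _)

/-- The bounds on `E` and `μ` may count the same atomic fault twice; the later counting never adds
them. -/
theorem genBy_idealCheck {B : CatBasis} {m : ℕ} {G : (idealCheck B).circuit.Fault}
    (h : (idealCheck B).circuit.GenBy G m) :
    ∃ (E : Fin 2 → Pauli) (μ : ZMod 2), flipWeight B E ≤ m ∧ (μ ≠ 0 → 1 ≤ m) ∧ ∀ κ k,
      (idealCheck B).circuit.sem G κ k ∝
        pauliString E * measMap (fun _ : Fin 2 => B.check) (k (.inr (.inl ())) + μ) := by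
  obtain ⟨S, hS⟩ : ∃ S : Fin 2 → Pauli, S = fun j => G (.inl j) := ⟨_, rfl⟩
  obtain ⟨Q, hQ⟩ : ∃ Q : Fin 2 → Pauli, Q = fun j => G (.inr (.inl (.inl j))) := ⟨_, rfl⟩
  obtain ⟨T, hT⟩ : ∃ T : Fin 2 → Pauli, T = fun j => G (.inr (.inl (.inr j))) := ⟨_, rfl⟩
  obtain ⟨U, hU⟩ : ∃ U : Fin 2 → Pauli, U = fun j => G (.inr (.inr j)) := ⟨_, rfl⟩
  -- The witnesses are those of `sem_idealCheck`: the product of all the Paulis, and the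
  -- anticommutation of `Q + S` with the check.
  refine ⟨_, _, ?_, fun h0 => ?_, sem_idealCheck B G S Q T U hS hQ hT hU⟩
  · obtain ⟨m₁, m₂, rfl, h₁, h₂⟩ := GenBy.seq h
    obtain ⟨m₃, m₄, rfl, h₃, h₄⟩ := GenBy.seq h₂
    have h₁ : flipWeight B S ≤ m₁ := by rw [hS]; exact h₁.of_wires.flipWeight_le B
    have h₄ : flipWeight B U ≤ m₄ := by rw [hU]; exact h₄.of_wires.flipWeight_le B
    have h₃ : flipWeight B (T + Q) ≤ m₃ := by
      rw [hT, hQ]; exact h₃.of_measure.flipWeight_measAtoms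
    have h₅ := flipWeight_add_le B U (T + (Q + S))
    have h₆ := flipWeight_add_le B (T + Q) S
    rw [add_assoc] at h₆
    omega
  · by_contra hm
    obtain rfl : m = 0 := by omega
    rw [h.eq_zero] at hS hQ
    have h1 : Q + S = 0 := by subst hS hQ; exact add_zero (0 : Fin 2 → Pauli)
    exact h0 (h1 ▸ sympl_zero_right _)

/-! ### Paulis acting on cat states -/

/-- The phase with which a Pauli acts on the vectors of the basis `B`. -/
def CatBasis.phase (B : CatBasis) (p : Pauli) : ℂ :=
  match B with
  | .Z => pauliPhase p
  | .X => pauliPhase p * sgn (p.1 * p.2)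

theorem CatBasis.phase_ne_zero (B : CatBasis) (p : Pauli) : B.phase p ≠ 0 := by
  cases B <;> simp [phase, pauliPhase_ne_zero, sgn_ne_zero]

@[simp] theorem CatBasis.phase_check (B : CatBasis) : B.phase B.check = 1 := by
  cases B <;> simp [phase, check, pauliPhase]

theorem CatBasis.vec_X (s t : ZMod 2) : CatBasis.X.vec s t = sgn (s * t) := by
  have h : (s = 1 ∧ t = 1) ↔ s * t = 1 := by revert s t; decide
  simp only [vec, sgn, h]

/-- After this computation the two bases need no separate treatment when Paulis act on cat states.
-/
theorem pauliMatrix_mul_vec (B : CatBasis) (p : Pauli) (s t : ZMod 2) :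
    ∑ u, pauliMatrix p t u * B.vec s u =
      B.phase p * sgn (B.checkPart p * s) * B.vec (s + B.flipPart p) t := by
  cases B
  · simp only [CatBasis.vec, mul_ite, mul_one, mul_zero, Finset.sum_ite_eq, Finset.mem_univ,
      if_true, pauliMatrix_apply, eq_comm (a := t)]
    rfl
  · have h (u : ZMod 2) : t = u + p.1 ↔ u = t + p.1 := by
      generalize p.1 = q
      revert t u q; decide
    simp only [CatBasis.vec_X, pauliMatrix_apply, h, ite_mul, zero_mul, Finset.sum_ite_eq',
      Finset.mem_univ, if_true, CatBasis.phase]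
    change _ = pauliPhase p * sgn (p.1 * p.2) * sgn (p.1 * s) * sgn ((s + p.2) * t)
    simp only [mul_add, add_mul, sgn_add, mul_comm p.1]
    ring

section Branch

variable {a : Type} [Fintype a]

/-- The product state of the basis vectors `B.vec (s j)`. -/
def branch (B : CatBasis) (s : a → ZMod 2) : QMap (Fin 0) a := fun x _ => ∏ j, B.vec (s j) (x j)

/-- The cat state on the wires `a`. -/
def catOn (B : CatBasis) (a : Type) [Fintype a] : QMap (Fin 0) a := fun x _ =>
  ∑ c : ZMod 2, ∏ j, B.vec c (x j)

theorem catOn_eq_sum (B : CatBasis) : catOn B a = ∑ c, branch B fun _ => c := by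
  ext x y
  rw [Matrix.sum_apply]
  rfl

theorem catOn_comp_equiv {a' : Type} [Fintype a'] (B : CatBasis) (e : a ≃ a') :
    (catOn B a).submatrix (fun (x : a' → ZMod 2) j => x (e j)) id = catOn B a' := by
  ext x y
  change ∑ c : ZMod 2, ∏ j, B.vec c (x (e j)) = ∑ c : ZMod 2, ∏ j, B.vec c (x j)
  exact Finset.sum_congr rfl fun c _ => Fintype.prod_equiv e (fun j => B.vec c (x (e j)))
    (fun j => B.vec c (x j)) fun _ => rfl

/-- The phase with which a Pauli string acts on `branch B s`. -/
def branchPhase (B : CatBasis) (P : a → Pauli) : ℂ := ∏ j, B.phase (P j)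

theorem branchPhase_ne_zero (B : CatBasis) (P : a → Pauli) : branchPhase B P ≠ 0 :=
  Finset.prod_ne_zero_iff.2 fun j _ => B.phase_ne_zero (P j)

theorem pauliString_mul_branch [DecidableEq a] (B : CatBasis) (P : a → Pauli) (s : a → ZMod 2) :
    pauliString P * branch B s =
      (branchPhase B P * sgn (∑ j, B.checkPart (P j) * s j)) •
        branch B fun j => s j + B.flipPart (P j) := by
  ext x y
  simp only [Matrix.mul_apply, pauliString, branch, ← Finset.prod_mul_distrib, Matrix.smul_apply,
    branchPhase, sgn_sum, smul_eq_mul, ← pauliMatrix_mul_vec, Fintype.prod_sum]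

/-- These are the stabilisers of the cat state up to sign: a uniform flip permutes the two branches,
and an even number of check parts gives both the same sign. -/
theorem pauliString_mul_catOn [DecidableEq a] {B : CatBasis} {P : a → Pauli} {e : ZMod 2}
    (h : ∀ j, B.flipPart (P j) = e) (h' : ∑ j, B.checkPart (P j) = 0) :
    pauliString P * catOn B a ∝ catOn B a := by
  refine ⟨branchPhase B P, branchPhase_ne_zero B P, ?_⟩
  simp only [catOn_eq_sum, Matrix.mul_sum, pauliString_mul_branch, ← Finset.sum_mul, h, h',
    zero_mul, sgn_zero, mul_one, ← Finset.smul_sum]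
  congr 1
  exact Fintype.sum_equiv (Equiv.addRight e) _ _ fun c => rfl

theorem pauliString_mul_catOn_congr [DecidableEq a] {B : CatBasis} {P Q : a → Pauli} {e : ZMod 2}
    (h : ∀ j, B.flipPart (P j) = B.flipPart (Q j) + e)
    (h' : ∑ j, B.checkPart (P j) = ∑ j, B.checkPart (Q j)) :
    pauliString P * catOn B a ∝ pauliString Q * catOn B a := by
  -- `P` and `Q` differ by a stabiliser.
  have h1 : pauliString (Q + P) * catOn B a ∝ catOn B a := by
    refine pauliString_mul_catOn (e := e) (fun j => ?_) ?_
    · rw [Pi.add_apply, map_add, h, ← add_assoc, zmod_two_add_self, zero_add]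
    · simp only [Pi.add_apply, map_add, Finset.sum_add_distrib, h', zmod_two_add_self]
  refine ScalarEq.trans ?_ (h1.mul_left (pauliString Q))
  rw [← Matrix.mul_assoc]
  refine ScalarEq.mul_right (ScalarEq.trans (.of_eq ?_) (pauliString_mul _ _).symm) _
  rw [← add_assoc, zmod_two_add_self, zero_add]

theorem catOn_ne_zero (B : CatBasis) : catOn B a ≠ 0 := by
  intro h
  -- At the all-zero string the branch `0` contributes `1`, and the other branch cannot cancel it.
  have h0 := congrFun (congrFun h 0) 0
  have h1 : B.vec 0 0 = 1 := by cases B <;> simp [CatBasis.vec]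
  have h2 : catOn B a 0 0 = 1 + B.vec 1 0 ^ Fintype.card a := by
    change ∑ c : Fin 2, ∏ j : a, B.vec c 0 = _
    rw [Fin.sum_univ_two, Finset.prod_const, Finset.prod_const]
    exact congrArg (· + _) ((congrArg (· ^ _) h1).trans (one_pow _))
  have h3 : (1 : ℂ) + B.vec 1 0 ^ Fintype.card a ≠ 0 := by
    cases B
    · by_cases hc : Fintype.card a = 0 <;> simp [CatBasis.vec, hc]
    · simp [CatBasis.vec]
  exact h3 (h2.symm.trans h0)

theorem branch_ne_zero (B : CatBasis) (s : a → ZMod 2) : branch B s ≠ 0 := by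
  intro h
  cases B
  · have := congrFun (congrFun h s) 0
    simp [branch, CatBasis.vec] at this
  · have := congrFun (congrFun h 0) 0
    simp [branch, CatBasis.vec] at this

end Branch

/-- A product of basis vectors is an eigenvector of the check with eigenvalue `sgn (s 0 + s 1)`, so
the projector keeps it or kills it. -/
theorem measMap_mul_branch (B : CatBasis) (s : Fin 2 → ZMod 2) (m : ZMod 2) :
    measMap (fun _ : Fin 2 => B.check) m * branch B s =
      (if s 0 + s 1 = m then (1 : ℂ) else 0) • branch B s := by
  have h : pauliString (fun _ : Fin 2 => B.check) * branch B s = sgn (s 0 + s 1) • branch B s := by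
    simp [pauliString_mul_branch, branchPhase]
  rw [measMap, Matrix.smul_mul, Matrix.add_mul, Matrix.smul_mul, h, Matrix.one_mul, smul_smul,
    ← sgn_add, ← one_smul ℂ (branch B s), smul_smul, ← add_smul, smul_smul, smul_smul]
  congr 1
  generalize s 0 + s 1 = t
  rcases zmod_two_cases t with rfl | rfl <;> rcases zmod_two_cases m with rfl | rfl <;>
    simp [zmod_two_add_self] <;> norm_num

/-! ### Two blocks of wires -/

section Blocks

variable {n : ℕ}

/-- The maps `N i` on the wires `(0, i)` and `(1, i)`. -/
def rows (N : Fin n → QMap (Fin 2) (Fin 2)) : QMap (Fin 2 × Fin n) (Fin 2 × Fin n) := fun x y =>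
  ∏ i, N i (fun s => x (s, i)) fun s => y (s, i)

/-- The states `V s` on the wires `(s, i)`. -/
def cols (V : Fin 2 → QMap (Fin 0) (Fin n)) : QMap (Fin 0) (Fin 2 × Fin n) := fun x y =>
  ∏ s, V s (fun i => x (s, i)) y

theorem sum_prod_rows (f : Fin n → (Fin 2 → ZMod 2) → ℂ) :
    ∑ w : Fin 2 × Fin n → ZMod 2, ∏ i, f i (fun s => w (s, i)) = ∏ i, ∑ w, f i w := by
  rw [Fintype.prod_sum]
  exact Fintype.sum_equiv ((Equiv.arrowCongr (Equiv.prodComm _ _) (Equiv.refl _)).trans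
    (Equiv.curry (Fin n) (Fin 2) (ZMod 2))) _ _ fun w => rfl

theorem sum_prod_cols (f : Fin 2 → (Fin n → ZMod 2) → ℂ) :
    ∑ w : Fin 2 × Fin n → ZMod 2, ∏ s, f s (fun i => w (s, i)) = ∏ s, ∑ w, f s w := by
  rw [Fintype.prod_sum]
  exact Fintype.sum_equiv (Equiv.curry (Fin 2) (Fin n) (ZMod 2)) _ _ fun w => rfl

theorem rows_mul (N N' : Fin n → QMap (Fin 2) (Fin 2)) :
    rows N * rows N' = rows fun i => N i * N' i := by
  ext x y
  simp only [Matrix.mul_apply, rows, ← Finset.prod_mul_distrib]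
  exact sum_prod_rows fun i w => N i (fun s => x (s, i)) w * N' i w fun s => y (s, i)

theorem ScalarEq.rows {N N' : Fin n → QMap (Fin 2) (Fin 2)} (h : ∀ i, N i ∝ N' i) :
    CatDoubling.rows N ∝ CatDoubling.rows N' := by
  choose z hz h using h
  refine ⟨∏ i, z i, Finset.prod_ne_zero_iff.2 fun i _ => hz i, ?_⟩
  ext x y
  simp [CatDoubling.rows, h, Finset.prod_mul_distrib]

theorem ScalarEq.cols {V V' : Fin 2 → QMap (Fin 0) (Fin n)} (h : ∀ s, V s ∝ V' s) :
    CatDoubling.cols V ∝ CatDoubling.cols V' := by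
  choose z hz h using h
  refine ⟨∏ i, z i, Finset.prod_ne_zero_iff.2 fun i _ => hz i, ?_⟩
  ext x y
  rw [funext h]
  simp [CatDoubling.cols, -Fin.prod_univ_two, Finset.prod_mul_distrib]

theorem rows_pauliString (P : Fin 2 × Fin n → Pauli) :
    (rows fun i => pauliString fun s => P (s, i)) = pauliString P := by
  ext x y
  simp only [rows, pauliString]
  exact (Fintype.prod_prod_type_right' fun s i =>
    pauliMatrix (P (s, i)) (x (s, i)) (y (s, i))).symm

theorem cols_pauliString_mul (P : Fin 2 × Fin n → Pauli) (V : Fin 2 → QMap (Fin 0) (Fin n)) :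
    (cols fun s => pauliString (fun i => P (s, i)) * V s) = pauliString P * cols V := by
  ext x y
  simp only [Matrix.mul_apply, cols, pauliString]
  rw [← sum_prod_cols fun s w => (∏ i, pauliMatrix (P (s, i)) (x (s, i)) (w i)) * V s w y]
  refine Finset.sum_congr rfl fun w _ => ?_
  rw [Finset.prod_mul_distrib, Fintype.prod_prod_type]

theorem rows_mul_branch {B : CatBasis} {N : Fin n → QMap (Fin 2) (Fin 2)}
    {σ : Fin 2 × Fin n → ZMod 2} {z : Fin n → ℂ}
    (h : ∀ i, (N i * branch B fun s => σ (s, i)) = z i • branch B fun s => σ (s, i)) :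
    rows N * branch B σ = (∏ i, z i) • branch B σ := by
  have h' (w : Fin 2 × Fin n → ZMod 2) (y : Fin 0 → ZMod 2) :
      branch B σ w y = ∏ i, branch B (fun s => σ (s, i)) (fun s => w (s, i)) y :=
    Fintype.prod_prod_type_right fun q => B.vec (σ q) (w q)
  ext x y
  simp only [Matrix.mul_apply, Matrix.smul_apply, h', rows, ← Finset.prod_mul_distrib,
    smul_eq_mul]
  rw [sum_prod_rows fun i w => N i (fun s => x (s, i)) w * branch B (fun s => σ (s, i)) w y]
  refine Finset.prod_congr rfl fun i _ => ?_
  exact congrFun (congrFun (h i) _) y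

/-- Two cat states expand into four branches, each constant on either block; all the checks are
diagonal on these. -/
theorem cols_catOn (B : CatBasis) :
    (cols fun _ => catOn B (Fin n)) =
      ∑ c₀ : ZMod 2, ∑ c₁ : ZMod 2, branch B fun q => if q.1 = 1 then c₁ else c₀ := by
  ext x y
  rw [Matrix.sum_apply]
  simp only [Matrix.sum_apply, cols, catOn, branch, Fin.prod_univ_two, Fintype.prod_prod_type,
    Finset.sum_mul_sum]
  simp

theorem rows_measMap_mul_cols (B : CatBasis) (μ : Fin n → ZMod 2) :
    (rows fun i => measMap (fun _ : Fin 2 => B.check) (μ i)) * (cols fun _ => catOn B (Fin n)) =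
      ∑ c₀ : ZMod 2, ∑ c₁ : ZMod 2, (∏ i, if c₀ + c₁ = μ i then (1 : ℂ) else 0) •
        branch B fun q => if q.1 = 1 then c₁ else c₀ := by
  rw [cols_catOn]
  simp only [Matrix.mul_sum]
  refine Finset.sum_congr rfl fun c₀ _ => Finset.sum_congr rfl fun c₁ _ => ?_
  exact rows_mul_branch fun i => measMap_mul_branch B (fun s => if s = 1 then c₁ else c₀) (μ i)

/-- On a branch every check reads the same value `c₀ + c₁`, so disagreeing values kill all four
branches. -/
theorem eq_of_rows_measMap_ne_zero {B : CatBasis} {μ : Fin n → ZMod 2}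
    (h : (rows fun i => measMap (fun _ : Fin 2 => B.check) (μ i)) *
      (cols fun _ => catOn B (Fin n)) ≠ 0)
    (i j : Fin n) : μ i = μ j := by
  by_contra hij
  refine h ?_
  rw [rows_measMap_mul_cols]
  refine Finset.sum_eq_zero fun c₀ _ => Finset.sum_eq_zero fun c₁ _ => ?_
  have : ∃ i, c₀ + c₁ ≠ μ i := by
    by_contra! h'
    exact hij ((h' i).symm.trans (h' j))
  obtain ⟨i, hi⟩ := this
  rw [Finset.prod_eq_zero (Finset.mem_univ i) (if_neg hi), zero_smul]

/-- The Pauli that exchanges the basis vectors on the second block if `m = 1`. -/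
def blockFlip (B : CatBasis) (n : ℕ) (m : ZMod 2) : Fin 2 × Fin n → Pauli := fun q =>
  if q.1 = 1 then m • B.flip else 0

theorem blockFlip_add (B : CatBasis) (n : ℕ) (m m' : ZMod 2) :
    blockFlip B n (m + m') = blockFlip B n m + blockFlip B n m' := by
  ext1 q
  by_cases hq : q.1 = 1 <;> simp [blockFlip, hq, add_smul]

theorem CatBasis.flipPart_smul_flip (B : CatBasis) (m : ZMod 2) : B.flipPart (m • B.flip) = m := by
  rcases zmod_two_cases m with rfl | rfl <;> simp

theorem CatBasis.checkPart_smul_flip (B : CatBasis) (m : ZMod 2) :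
    B.checkPart (m • B.flip) = 0 := by
  rcases zmod_two_cases m with rfl | rfl <;> simp

/-- Agreeing checks with value `m` keep the branches with `c₁ = c₀ + m`: the two cat states merge
into one, up to a flip of the second block. -/
theorem rows_measMap_const (B : CatBasis) (m : ZMod 2) :
    (rows fun _ : Fin n => measMap (fun _ : Fin 2 => B.check) m) * (cols fun _ => catOn B (Fin n)) ∝
      pauliString (blockFlip B n m) * catOn B (Fin 2 × Fin n) := by
  have h : pauliString (blockFlip B n m) * catOn B (Fin 2 × Fin n) ∝
      ∑ c : ZMod 2, branch B fun q : Fin 2 × Fin n => if q.1 = 1 then c + m else c := by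
    refine ⟨_, branchPhase_ne_zero B (blockFlip B n m), ?_⟩
    have h1 (q : Fin 2 × Fin n) : B.checkPart (blockFlip B n m q) = 0 := by
      unfold blockFlip; split_ifs <;> simp [B.checkPart_smul_flip]
    rw [catOn_eq_sum, Matrix.mul_sum, Finset.smul_sum]
    refine Finset.sum_congr rfl fun c _ => ?_
    simp only [pauliString_mul_branch, h1, zero_mul, Finset.sum_const_zero, sgn_zero, mul_one]
    congr 2
    ext1 q
    unfold blockFlip; split_ifs <;> simp [B.flipPart_smul_flip]
  refine ScalarEq.trans ?_ h.symm
  rw [rows_measMap_mul_cols]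
  rcases Nat.eq_zero_or_pos n with rfl | hn
  -- Without legs there are no checks, so four branches survive instead of two.
  · refine ⟨2, two_ne_zero, ?_⟩
    ext x y
    simp [Matrix.sum_apply, branch]
  · refine .of_eq (Finset.sum_congr rfl fun c₀ _ => ?_)
    rw [Finset.sum_eq_single (c₀ + m)]
    · simp [← add_assoc, zmod_two_add_self]
    · intro c₁ _ hc
      have hc : c₀ + c₁ ≠ m := by
        rintro rfl
        exact hc (by rw [← add_assoc, zmod_two_add_self, zero_add])
      simp [hc, hn.ne']
    · simp

end Blocks

/-! ### Detectability -/

namespace Circuit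

variable {o a b : Type} {C : Circuit Empty o a b}

theorem not_detectable_zero {k : o → ZMod 2} (h : C.sem 0 Empty.elim k ≠ 0) :
    ¬ C.Detectable 0 := by
  rintro ⟨f, β, h0, h1⟩
  simpa using (h0 k h).symm.trans (h1 k h)

/-- A fault shifts the outcomes and acts by a Pauli string on the outputs. -/
theorem exists_shift [Fintype a] [Fintype b] [DecidableEq b] (C : Circuit Empty o a b)
    (F : C.Fault) : ∃ (E : b → Pauli) (s : o → ZMod 2), ∀ k,
      C.sem F Empty.elim k ∝ pauliString E * C.sem 0 Empty.elim (k + s) := by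
  classical
  obtain ⟨E, s, h⟩ := exists_propagation C F 0 0
  refine ⟨E, s, fun k => ?_⟩
  have := h Empty.elim k
  rwa [pauliString_zero, Matrix.mul_one, Subsingleton.elim (Empty.elim + 0) Empty.elim] at this

/-- If the shift `s` changed a predetermined parity, that parity would be predetermined with the
opposite value in the faulty circuit and would detect the fault. -/
theorem linear_eq_zero_of_not_detectable [Fintype b] [DecidableEq b] {F : C.Fault}
    (hF : ¬ C.Detectable F) {E : b → Pauli} {s : o → ZMod 2}
    (hs : ∀ k, C.sem F Empty.elim k ∝ pauliString E * C.sem 0 Empty.elim (k + s))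
    {f : ParityForm o} {β : ZMod 2} (hf : C.Predetermined 0 f β) : f.linear s = 0 := by
  rcases zmod_two_cases (f.linear s) with h | h
  · exact h
  · refine absurd ⟨f, β, hf, fun k hk => ?_⟩ hF
    have := hf _ ((pauliString_mul_ne_zero _ _).1 ((hs k).ne_zero_iff.1 hk))
    rw [ParityForm.eval_add, h] at this
    rw [← this, add_assoc, zmod_two_add_self, add_zero]

end Circuit

namespace Protocol

variable {ρ a b : Type} {D D' : Protocol ρ a b}

theorem FaultEquiv.sameMap_zero (h : D.FaultEquiv D') {k : D'.Outcome → ZMod 2}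
    (hk : D'.circuit.sem 0 Empty.elim k ≠ 0) : SameMap D' D 0 0 := by
  have h0 : D'.circuit.wt 0 = 0 := Nat.le_zero.1 (GenBy.wt_le SumOf.zero)
  -- `w = 1` is the least value that covers weight `0`; the matching fault then has weight `0` and
  -- is trivial.
  rcases (h 1).2.2 0 (zero_mem _) (by omega) with hd | ⟨F, hF, hw, hs⟩
  · exact absurd hd (not_detectable_zero hk)
  · have h1 := genBy_wt hF
    rw [show D.circuit.wt F = 0 by omega] at h1
    exact h1.eq_zero ▸ hs

theorem FaultEquiv.exists_sameMap (h : D.FaultEquiv D') {F : D.circuit.Fault} {m : ℕ}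
    (hF : D.circuit.GenBy F m) (hd : ¬ D.circuit.Detectable F) :
    ∃ G m', m' ≤ m ∧ D'.circuit.GenBy G m' ∧ SameMap D D' F G := by
  obtain ⟨G, hG, hw, hs⟩ := ((h (D.circuit.wt F + 1)).2.1 F hF.mem_faultGroup
    (Nat.lt_succ_self _)).resolve_left hd
  exact ⟨G, _, hw.trans hF.wt_le, genBy_wt hG, hs⟩

/-- The shift of the outcomes by an undetectable fault respects the constraints. -/
theorem Total.admissible_add [Fintype b] [DecidableEq b] (h : D.Total) {F : D.circuit.Fault}
    (hF : ¬ D.circuit.Detectable F) {E : b → Pauli} {s : D.Outcome → ZMod 2}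
    (hs : ∀ k, D.circuit.sem F Empty.elim k ∝ pauliString E * D.circuit.sem 0 Empty.elim (k + s))
    {k : D.Outcome → ZMod 2} (hk : D.Admissible k) : D.Admissible (k + s) := by
  intro f hf
  rw [ParityForm.eval_add, hk f hf,
    linear_eq_zero_of_not_detectable hF hs (f := f) (β := 0) fun k hk => h k hk f hf, add_zero]

end Protocol

/-! ### Faults on the ingredients -/

section Ingredients

variable {B : CatBasis} {n : ℕ}

theorem sem_idealCat_zero (κ : Empty → ZMod 2) (k : (idealCat B n).Outcome → ZMod 2) :
    (idealCat B n).circuit.sem 0 κ k = catMap B n := by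
  refine (sem_seq _ _ _ _ _).trans ?_
  refine (congrArg₂ (· * ·) (sem_wires_zero _ _) (sem_gate_zero _ _ _ _)).trans ?_
  exact Matrix.one_mul _

theorem idealCat_admissible (k : (idealCat B n).Outcome → ZMod 2) :
    (idealCat B n).Admissible k := fun _ h => h.elim

theorem idealCheck_admissible (k : (idealCheck B).Outcome → ZMod 2) :
    (idealCheck B).Admissible k := fun _ h => h.elim

theorem FaultTolerantCat.exists_admissible {D : Protocol Empty (Fin 0) (Fin n)}
    (h : FaultTolerantCat B n D) : ∃ k, D.Admissible k := by
  have h1 : (fun r => r.elim : Empty → ZMod 2) ∈ (idealCat B n).report ''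
      {k | (idealCat B n).Admissible k} :=
    ⟨fun _ => 0, idealCat_admissible _, Subsingleton.elim _ _⟩
  rw [← (h 0).1] at h1
  obtain ⟨k, hk, -⟩ := h1
  exact ⟨k, hk⟩

theorem FaultTolerantCheck.exists_admissible {D : Protocol Unit (Fin 2) (Fin 2)}
    (h : FaultTolerantCheck B D) (r : ZMod 2) :
    ∃ k, D.Admissible k ∧ (D.readout ()).eval k = r := by
  have h1 : (fun _ => r : Unit → ZMod 2) ∈ (idealCheck B).report ''
      {k | (idealCheck B).Admissible k} :=
    ⟨fun _ => r, idealCheck_admissible _, funext fun _ => ParityForm.eval_single _ _⟩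
  rw [← (h 0).1] at h1
  obtain ⟨k, hk, hr⟩ := h1
  exact ⟨k, hk, congrFun hr ()⟩

theorem FaultTolerantCat.sem_zero {D : Protocol Empty (Fin 0) (Fin n)}
    (h : FaultTolerantCat B n D) {k : D.Outcome → ZMod 2} (hk : D.Admissible k) :
    D.circuit.sem 0 Empty.elim k ∝ catMap B n := by
  have h1 := Protocol.FaultEquiv.sameMap_zero h (k := fun _ => 0)
    (by rw [sem_idealCat_zero]; exact catOn_ne_zero B)
  have h2 := h1 (fun _ => 0) k (idealCat_admissible _) hk (Subsingleton.elim _ _)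
  rw [sem_idealCat_zero] at h2
  exact ScalarEq.symm h2

theorem FaultTolerantCat.sem_fault {D : Protocol Empty (Fin 0) (Fin n)}
    (h : FaultTolerantCat B n D) {F : D.circuit.Fault} {m : ℕ} (hF : D.circuit.GenBy F m)
    (hd : ¬ D.circuit.Detectable F) : ∃ P : Fin n → Pauli, flipWeight B P ≤ m ∧
      ∀ k, D.Admissible k → D.circuit.sem F Empty.elim k ∝ pauliString P * catMap B n := by
  obtain ⟨G, m', hm, hG, hs⟩ := Protocol.FaultEquiv.exists_sameMap h hF hd
  obtain ⟨P, m'', hm', hP, hs'⟩ := genBy_idealCat hG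
  refine ⟨P, (hP.flipWeight_le B).trans (hm'.trans hm), fun k hk => ?_⟩
  have := hs k (fun _ => 0) hk (idealCat_admissible _) (Subsingleton.elim _ _)
  rwa [hs'] at this

/-- The measurement of the parity check. -/
abbrev checkMap (B : CatBasis) (m : ZMod 2) : QMap (Fin 2) (Fin 2) :=
  measMap (fun _ => B.check) m

theorem sem_idealCheck_zero (k : (idealCheck B).Outcome → ZMod 2) :
    (idealCheck B).circuit.sem 0 Empty.elim k ∝ checkMap B (k (.inr (.inl ()))) := by
  have := sem_idealCheck B 0 0 0 0 0 rfl rfl rfl rfl Empty.elim k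
  simpa only [add_zero, sympl_zero_right, pauliString_zero, Matrix.one_mul] using this

theorem checkMap_ne_zero (B : CatBasis) (m : ZMod 2) : checkMap B m ≠ 0 := by
  intro h
  have h1 := measMap_mul_branch B (fun s => if s = 1 then m else 0) m
  have h : measMap (fun _ : Fin 2 => B.check) m = 0 := h
  rw [h, Matrix.zero_mul] at h1
  simp only [zero_ne_one, if_false, if_true, zero_add, one_smul] at h1
  exact branch_ne_zero B _ h1.symm

theorem FaultTolerantCheck.sem_zero {D : Protocol Unit (Fin 2) (Fin 2)}
    (h : FaultTolerantCheck B D) {k : D.Outcome → ZMod 2} (hk : D.Admissible k) :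
    D.circuit.sem 0 Empty.elim k ∝ checkMap B ((D.readout ()).eval k) := by
  have h1 := Protocol.FaultEquiv.sameMap_zero h (k := fun _ => 0)
    ((sem_idealCheck_zero _).ne_zero_iff.2 (checkMap_ne_zero B _))
  have h2 := h1 (fun _ => (D.readout ()).eval k) k (idealCheck_admissible _) hk
    (funext fun _ => ParityForm.eval_single _ _)
  exact (ScalarEq.symm h2).trans (sem_idealCheck_zero _)

theorem FaultTolerantCheck.sem_fault {D : Protocol Unit (Fin 2) (Fin 2)}
    (h : FaultTolerantCheck B D) {F : D.circuit.Fault} {m : ℕ} (hF : D.circuit.GenBy F m)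
    (hd : ¬ D.circuit.Detectable F) : ∃ (E : Fin 2 → Pauli) (μ : ZMod 2),
      flipWeight B E ≤ m ∧ (μ ≠ 0 → 1 ≤ m) ∧ ∀ k, D.Admissible k →
        D.circuit.sem F Empty.elim k ∝
          pauliString E * checkMap B ((D.readout ()).eval k + μ) := by
  obtain ⟨G, m', hm, hG, hs⟩ := Protocol.FaultEquiv.exists_sameMap h hF hd
  obtain ⟨E, μ, hE, hμ, hs'⟩ := genBy_idealCheck hG
  refine ⟨E, μ, hE.trans hm, fun h => (hμ h).trans hm, fun k hk => ?_⟩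
  have := hs k (fun _ => (D.readout ()).eval k) hk (idealCheck_admissible _)
    (funext fun _ => (ParityForm.eval_single _ _).symm)
  exact ScalarEq.trans this (hs' _ _)

end Ingredients

/-! ### The doubled circuit -/

section Doubled

variable {B : CatBasis} {n : ℕ} {C : Fin 2 → Protocol Empty (Fin 0) (Fin n)}
  {M : Fin n → Protocol Unit (Fin 2) (Fin 2)}

/-- The part of a fault on the output wires. -/
def outFault (F : (doubledCat B n C M).circuit.Fault) : Fin 2 × Fin n → Pauli := fun q => F (.inr q)

/-- The part of a fault on a parity check. -/
def checkFault (F : (doubledCat B n C M).circuit.Fault) (i : Fin n) : (M i).circuit.Fault :=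
  fun l => F (.inl (.inl (.inr ⟨i, l⟩)))

/-- The part of a fault on a preparation. -/
def prepFault (F : (doubledCat B n C M).circuit.Fault) (s : Fin 2) : (C s).circuit.Fault :=
  fun l => F (.inl (.inl (.inl ⟨s, l⟩)))

/-- The outcomes of a parity check. -/
def checkBits (k : DoubledOutcome n C M → ZMod 2) (i : Fin n) : (M i).Outcome → ZMod 2 :=
  fun v => k (checkOutcome n C M i v)

/-- The outcomes of a preparation. -/
def prepBits (k : DoubledOutcome n C M → ZMod 2) (s : Fin 2) : (C s).Outcome → ZMod 2 :=
  fun v => k (prepOutcome n C M s v)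

/-- The reported outcome of a parity check. -/
def checkValue (k : DoubledOutcome n C M → ZMod 2) (i : Fin n) : ZMod 2 :=
  ((M i).readout ()).eval (checkBits k i)

/-- Normal form of the circuit: output faults, correction, checks by rows, preparations by columns.
The relabellings survive only in the final numbering of the legs. -/
theorem sem_doubledCat (F : (doubledCat B n C M).circuit.Fault)
    (k : DoubledOutcome n C M → ZMod 2) :
    (doubledCat B n C M).circuit.sem F Empty.elim k =
      (pauliString (outFault F) *
        (pauliString (fun q : Fin 2 × Fin n => if q.1 = 1 then checkValue k q.2 • B.flip else 0) *
          ((rows fun i => (M i).circuit.sem (checkFault F i) Empty.elim (checkBits k i)) *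
            cols fun s => (C s).circuit.sem (prepFault F s) Empty.elim (prepBits k s)))).submatrix
        (fun (x : Fin (2 * n) → ZMod 2) j => x (finProdFinEquiv j)) id := by
  have hE (f : Empty → ZMod 2) : f = Empty.elim := Subsingleton.elim _ _
  refine (sem_relabel _ _ _ _ _ _ _ _).trans ?_
  refine congrArg (fun A => Matrix.submatrix A _ _) ?_
  refine (sem_seq _ _ _ _ _).trans (congrArg₂ (· * ·) rfl ?_)
  refine (sem_seq _ _ _ _ _).trans (congrArg₂ (· * ·) ?_ ?_)
  · refine (sem_correct _ _ _ _ _).trans (congrArg _ (funext fun q => ?_))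
    by_cases hq : q.1 = 1
    · rw [if_pos hq, if_pos hq, ParityForm.eval_map]
      rfl
    · rw [if_neg hq, if_neg hq, smul_zero]
  refine (sem_seq _ _ _ _ _).trans (congrArg₂ (· * ·) ?_ ?_)
  · exact congrArg rows (funext fun i => congrArg (fun κ => (M i).circuit.sem _ κ _) (hE _))
  · ext x y
    have h (s : Fin 2) (κ : Empty → ZMod 2) (y' : Fin 0 → ZMod 2) :
        (C s).circuit.sem (prepFault F s) κ (prepBits k s) (fun i => x (s, i)) y' =
          (C s).circuit.sem (prepFault F s) Empty.elim (prepBits k s) (fun i => x (s, i)) y := by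
      rw [hE κ, Subsingleton.elim y' y]
    exact congrArg (fun f : Fin 2 → ℂ => ∏ s, f s) (funext fun s => h s _ _)

theorem eval_map_prepOutcome (k : DoubledOutcome n C M → ZMod 2) (s : Fin 2)
    (f : ParityForm (C s).Outcome) :
    (f.map (prepOutcome n C M s)).eval k = f.eval (prepBits k s) := ParityForm.eval_map _ _ _

theorem eval_map_checkOutcome (k : DoubledOutcome n C M → ZMod 2) (i : Fin n)
    (f : ParityForm (M i).Outcome) :
    (f.map (checkOutcome n C M i)).eval k = f.eval (checkBits k i) := ParityForm.eval_map _ _ _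

theorem eval_checks_eq_zero_iff (k : DoubledOutcome n C M → ZMod 2) (i j : Fin n) :
    ((((M i).readout ()).map (checkOutcome n C M i)).xor
      (((M j).readout ()).map (checkOutcome n C M j))).eval k = 0 ↔
        checkValue k i = checkValue k j := by
  have h (a b : ZMod 2) : a + b = 0 ↔ a = b := by revert a b; decide
  rw [ParityForm.eval_xor, eval_map_checkOutcome, eval_map_checkOutcome, h, checkValue, checkValue]

theorem doubledCat_admissible_iff {k : DoubledOutcome n C M → ZMod 2} :
    (doubledCat B n C M).Admissible k ↔ (∀ s, (C s).Admissible (prepBits k s)) ∧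
      (∀ i, (M i).Admissible (checkBits k i)) ∧ ∀ i j, checkValue k i = checkValue k j := by
  constructor
  · intro h
    exact ⟨fun s f hf => (eval_map_prepOutcome k s f).symm.trans (h _ (.inl ⟨s, f, hf, rfl⟩)),
      fun i f hf => (eval_map_checkOutcome k i f).symm.trans (h _ (.inr (.inl ⟨i, f, hf, rfl⟩))),
      fun i j => (eval_checks_eq_zero_iff k i j).1 (h _ (.inr (.inr ⟨i, j, rfl⟩)))⟩
  · rintro ⟨h, h', h''⟩ _ (⟨s, f, hf, rfl⟩ | ⟨i, f, hf, rfl⟩ | ⟨i, j, rfl⟩)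
    · exact (eval_map_prepOutcome k s f).trans (h s f hf)
    · exact (eval_map_checkOutcome k i f).trans (h' i f hf)
    · exact (eval_checks_eq_zero_iff k i j).2 (h'' i j)

theorem prep_ne_zero {F : (doubledCat B n C M).circuit.Fault} {k : DoubledOutcome n C M → ZMod 2}
    (h : (doubledCat B n C M).circuit.sem F Empty.elim k ≠ 0) (s : Fin 2) :
    (C s).circuit.sem (prepFault F s) Empty.elim (prepBits k s) ≠ 0 := by
  intro h0
  refine h ?_
  have : (cols fun s => (C s).circuit.sem (prepFault F s) Empty.elim (prepBits k s)) = 0 := by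
    ext x y
    exact Finset.prod_eq_zero (Finset.mem_univ s) (congrFun (congrFun h0 _) _)
  rw [sem_doubledCat, this, Matrix.mul_zero, Matrix.mul_zero, Matrix.mul_zero]
  rfl

theorem check_ne_zero {F : (doubledCat B n C M).circuit.Fault} {k : DoubledOutcome n C M → ZMod 2}
    (h : (doubledCat B n C M).circuit.sem F Empty.elim k ≠ 0) (i : Fin n) :
    (M i).circuit.sem (checkFault F i) Empty.elim (checkBits k i) ≠ 0 := by
  intro h0
  refine h ?_
  have : (rows fun i => (M i).circuit.sem (checkFault F i) Empty.elim (checkBits k i)) = 0 := by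
    ext x y
    exact Finset.prod_eq_zero (Finset.mem_univ i) (congrFun (congrFun h0 _) _)
  rw [sem_doubledCat, this, Matrix.zero_mul, Matrix.mul_zero, Matrix.mul_zero]
  rfl

/-- An outcome that can occur in the whole circuit restricts to one that can occur in the
ingredient, with or without faults. -/
theorem detectable_of_prep {F : (doubledCat B n C M).circuit.Fault} {s : Fin 2}
    (h : (C s).circuit.Detectable (prepFault F s)) :
    (doubledCat B n C M).circuit.Detectable F := by
  obtain ⟨f, β, h0, h1⟩ := h
  exact ⟨f.map (prepOutcome n C M s), β,
    fun k hk => (eval_map_prepOutcome k s f).trans (h0 _ (prep_ne_zero hk s)),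
    fun k hk => (eval_map_prepOutcome k s f).trans (h1 _ (prep_ne_zero hk s))⟩

theorem detectable_of_check {F : (doubledCat B n C M).circuit.Fault} {i : Fin n}
    (h : (M i).circuit.Detectable (checkFault F i)) :
    (doubledCat B n C M).circuit.Detectable F := by
  obtain ⟨f, β, h0, h1⟩ := h
  exact ⟨f.map (checkOutcome n C M i), β,
    fun k hk => (eval_map_checkOutcome k i f).trans (h0 _ (check_ne_zero hk i)),
    fun k hk => (eval_map_checkOutcome k i f).trans (h1 _ (check_ne_zero hk i))⟩

theorem genBy_doubledCat {F : (doubledCat B n C M).circuit.Fault} {m : ℕ}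
    (h : (doubledCat B n C M).circuit.GenBy F m) :
    ∃ (p : Fin 2 → ℕ) (q : Fin n → ℕ) (r : ℕ), ∑ s, p s + ∑ i, q i + r = m ∧
      (∀ s, (C s).circuit.GenBy (prepFault F s) (p s)) ∧
      (∀ i, (M i).circuit.GenBy (checkFault F i) (q i)) ∧ flipWeight B (outFault F) ≤ r := by
  obtain ⟨m₁, r, rfl, h₁, hr⟩ := GenBy.seq h
  obtain ⟨m₂, m₀, rfl, h₂, h₀⟩ := GenBy.seq h₁
  obtain ⟨m₃, m₄, rfl, h₃, h₄⟩ := GenBy.seq h₂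
  obtain ⟨p, rfl, hp⟩ := GenBy.par h₃
  obtain ⟨q, rfl, hq⟩ := GenBy.par h₄
  -- The share `m₀` of the correction is simply added to the bound for the output wires.
  exact ⟨p, q, m₀ + r, by ring, hp, hq,
    (hr.of_wires.flipWeight_le B).trans (Nat.le_add_left _ _)⟩

end Doubled

/-! ### Light representatives of Paulis on cat states -/

section Light

variable {a : Type} [Fintype a] {B : CatBasis}

/-- Only the total parity of the check parts matters on a cat state, so all of them can be collected
on one wire `j₀`. If some wire is flipped, `j₀` is chosen there at no cost; otherwise `0 < t` pays
for it. -/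
theorem exists_support_le [DecidableEq a] {P : a → Pauli} {t : ℕ} (h : flipWeight B P ≤ t)
    (ht : 0 < t) : ∃ Q : a → Pauli, {j | Q j ≠ 0}.ncard ≤ t ∧
      pauliString P * catOn B a ∝ pauliString Q * catOn B a := by
  rcases isEmpty_or_nonempty a with _ | ⟨⟨j₁⟩⟩
  · exact ⟨0, by simp, .of_eq (by rw [Subsingleton.elim P 0])⟩
  let T : Set a := {j | B.flipPart (P j) ≠ 0}
  obtain ⟨j₀, hj₀⟩ : ∃ j₀, (insert j₀ T).ncard ≤ t := by
    rcases T.eq_empty_or_nonempty with hT | ⟨j₀, hj₀⟩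
    · exact ⟨j₁, by rw [hT, insert_empty_eq, Set.ncard_singleton]; exact ht⟩
    · exact ⟨j₀, by rw [Set.insert_eq_of_mem hj₀]; exact h⟩
  refine ⟨fun j => B.flipPart (P j) • B.flip +
    if j = j₀ then (∑ j, B.checkPart (P j)) • B.check else 0, ?_, ?_⟩
  · refine (Set.ncard_le_ncard (fun j hj => ?_) (Set.toFinite _)).trans hj₀
    by_contra h'
    rw [Set.mem_insert_iff, not_or] at h'
    have h1 : B.flipPart (P j) = 0 := not_not.1 h'.2
    exact hj (by simp [h1, h'.1])
  · have h1 (m : ZMod 2) : B.flipPart (m • B.check) = 0 ∧ B.checkPart (m • B.check) = m := by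
      rcases zmod_two_cases m with rfl | rfl <;> simp
    refine pauliString_mul_catOn_congr (e := 0) (fun j => ?_) ?_
    · rw [map_add, B.flipPart_smul_flip, apply_ite B.flipPart, (h1 _).1, map_zero, ite_self,
        add_zero, add_zero]
    · simp only [map_add, B.checkPart_smul_flip, zero_add, apply_ite B.checkPart, (h1 _).2,
        map_zero, Finset.sum_ite_eq', Finset.mem_univ, if_true]

/-- Each wire is flipped by exactly one of the two strings. -/
theorem flipWeight_add_flipWeight_flip (P : a → Pauli) :
    flipWeight B P + flipWeight B (P + fun _ => B.flip) = Fintype.card a := by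
  rw [flipWeight_eq_sum, flipWeight_eq_sum, ← Finset.sum_add_distrib, Fintype.card_eq_sum_ones]
  refine Finset.sum_congr rfl fun j _ => ?_
  rw [Pi.add_apply, map_add, B.flipPart_flip]
  generalize B.flipPart (P j) = s
  revert s; decide

theorem exists_support_le_of_or [DecidableEq a] {P : a → Pauli} {t : ℕ}
    (h : flipWeight B P ≤ t ∨ flipWeight B (P + fun _ => B.flip) ≤ t) (ht : 0 < t) :
    ∃ Q : a → Pauli, {j | Q j ≠ 0}.ncard ≤ t ∧
      pauliString P * catOn B a ∝ pauliString Q * catOn B a := by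
  rcases h with h | h
  · exact exists_support_le h ht
  · obtain ⟨Q, hQ, h'⟩ := exists_support_le h ht
    refine ⟨Q, hQ, ScalarEq.trans (pauliString_mul_catOn_congr (e := 1) (fun j => ?_) ?_) h'⟩
    · rw [Pi.add_apply, map_add, B.flipPart_flip, add_assoc, zmod_two_add_self, add_zero]
    · simp

end Light

/-! ### Counting flips in the doubled circuit -/

section Weights

variable {B : CatBasis} {n : ℕ}

theorem flipWeight_eq_sum_cols (B : CatBasis) (P : Fin 2 × Fin n → Pauli) :
    flipWeight B P = ∑ s, flipWeight B fun i => P (s, i) := by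
  simp only [flipWeight_eq_sum, Fintype.sum_prod_type]

theorem flipWeight_eq_sum_rows (B : CatBasis) (P : Fin 2 × Fin n → Pauli) :
    flipWeight B P = ∑ i, flipWeight B fun s => P (s, i) := by
  simp only [flipWeight_eq_sum, Fintype.sum_prod_type_right]

theorem flipWeight_doubled_le {P E O : Fin 2 × Fin n → Pauli} {m : Fin n → ZMod 2} {δ : ZMod 2}
    {p : Fin 2 → ℕ} {q : Fin n → ℕ} {r : ℕ} (hP : ∀ s, flipWeight B (fun i => P (s, i)) ≤ p s)
    (hE : ∀ i, flipWeight B (fun s => E (s, i)) ≤ q i) (hm : ∀ i, m i ≠ 0 → 1 ≤ q i)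
    (hO : flipWeight B O ≤ r)
    (hδ : ∀ i, m i + (B.flipPart (P (0, i)) + B.flipPart (P (1, i))) = δ) :
    flipWeight B (O + (E + P) + blockFlip B n δ) ≤ ∑ s, p s + ∑ i, q i + r ∨
      flipWeight B (O + (E + P) + blockFlip B n δ + fun _ => B.flip) ≤
        ∑ s, p s + ∑ i, q i + r := by
  have hP' : flipWeight B P ≤ ∑ s, p s := by
    rw [flipWeight_eq_sum_cols]
    exact Finset.sum_le_sum fun s _ => hP s
  have hE' : flipWeight B E ≤ ∑ i, q i := by
    rw [flipWeight_eq_sum_rows]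
    exact Finset.sum_le_sum fun i _ => hE i
  rcases zmod_two_cases δ with rfl | rfl
  · left
    have h0 : blockFlip B n 0 = 0 := by ext1 j; simp [blockFlip]
    rw [h0, add_zero]
    have h1 := flipWeight_add_le B O (E + P)
    have h2 := flipWeight_add_le B E P
    omega
  · have h1 := flipWeight_add_flipWeight_flip (B := B) (O + (E + P) + blockFlip B n 1)
    rw [Fintype.card_prod, Fintype.card_fin, Fintype.card_fin] at h1
    -- For `δ = 1` each row has `m i = 1`, which costs a fault on its check, or an odd number of
    -- flips of `P`. With `h1`, the lighter of the two strings has at most `n` flips.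
    have h2 : n ≤ ∑ i, q i + flipWeight B P := by
      rw [flipWeight_eq_sum_rows, ← Finset.sum_add_distrib]
      calc n = ∑ _i : Fin n, 1 := by simp
        _ ≤ _ := Finset.sum_le_sum fun i _ => ?_
      rw [flipWeight_eq_sum, Fin.sum_univ_two]
      have hi := hδ i
      have hi' := hm i
      generalize m i = x at hi hi'
      generalize q i = y at hi'
      generalize B.flipPart (P (0, i)) = z at hi ⊢
      generalize B.flipPart (P (1, i)) = w at hi ⊢
      rcases zmod_two_cases x with rfl | rfl
      · have : 1 ≤ z.val + w.val := by revert z w; decide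
        omega
      · have := hi' one_ne_zero
        omega
    omega

end Weights

/-! ### The doubled circuit with faults -/

section Main

variable {B : CatBasis} {n : ℕ} {C : Fin 2 → Protocol Empty (Fin 0) (Fin n)}
  {M : Fin n → Protocol Unit (Fin 2) (Fin 2)}

theorem rows_checkMap_mul_pauliString (μ : Fin n → ZMod 2) (P : Fin 2 × Fin n → Pauli) :
    (rows fun i => checkMap B (μ i)) * pauliString P = pauliString P *
      rows fun i => checkMap B (μ i + (B.flipPart (P (0, i)) + B.flipPart (P (1, i)))) := by
  rw [← rows_pauliString, rows_mul, rows_mul]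
  refine congrArg rows (funext fun i => ?_)
  rw [measMap_mul_pauliString]
  simp [sympl, B.symp_check]

theorem submatrix_pauliString_mul_catOn (U : Fin 2 × Fin n → Pauli) :
    (pauliString U * catOn B (Fin 2 × Fin n)).submatrix
        (fun (x : Fin (2 * n) → ZMod 2) j => x (finProdFinEquiv j)) id =
      pauliString (fun j => U (finProdFinEquiv.symm j)) * catMap B (2 * n) := by
  rw [submatrix_mul_relabel finProdFinEquiv, catOn_comp_equiv, pauliString_comp_equiv]
  rfl

/-- All Paulis are moved to the outputs; only `P` crosses the checks, and it shifts their values. -/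
theorem sem_doubledCat_of_parts {F : (doubledCat B n C M).circuit.Fault}
    {k : DoubledOutcome n C M → ZMod 2} {P E : Fin 2 × Fin n → Pauli} {m : Fin n → ZMod 2}
    (hC : ∀ s, (C s).circuit.sem (prepFault F s) Empty.elim (prepBits k s) ∝
      pauliString (fun i => P (s, i)) * catMap B n)
    (hM : ∀ i, (M i).circuit.sem (checkFault F i) Empty.elim (checkBits k i) ∝
      pauliString (fun s => E (s, i)) * checkMap B (checkValue k i + m i)) :
    (doubledCat B n C M).circuit.sem F Empty.elim k ∝
      (pauliString (outFault F +
        ((fun q : Fin 2 × Fin n => if q.1 = 1 then checkValue k q.2 • B.flip else 0) +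
        (E + P))) * ((rows fun i => checkMap B (checkValue k i + m i +
          (B.flipPart (P (0, i)) + B.flipPart (P (1, i))))) *
            cols fun _ => catOn B (Fin n))).submatrix
        (fun (x : Fin (2 * n) → ZMod 2) j => x (finProdFinEquiv j)) id := by
  rw [sem_doubledCat]
  refine ScalarEq.submatrix ?_ _ _
  have h : (rows fun i => (M i).circuit.sem (checkFault F i) Empty.elim (checkBits k i)) *
      (cols fun s => (C s).circuit.sem (prepFault F s) Empty.elim (prepBits k s)) ∝
        pauliString (E + P) * ((rows fun i => checkMap B (checkValue k i + m i +
          (B.flipPart (P (0, i)) + B.flipPart (P (1, i))))) *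
            cols fun _ => catOn B (Fin n)) := by
    refine ((ScalarEq.rows hM).mul (ScalarEq.cols hC)).trans ?_
    rw [← rows_mul, rows_pauliString, cols_pauliString_mul, Matrix.mul_assoc,
      ← Matrix.mul_assoc (rows _), rows_checkMap_mul_pauliString, Matrix.mul_assoc,
      ← Matrix.mul_assoc]
    exact (pauliString_mul _ _).mul_right _
  refine ((h.mul_left _).mul_left _).trans ?_
  rw [← Matrix.mul_assoc (pauliString _) (pauliString (E + P))]
  refine (((pauliString_mul _ _).mul_right _).mul_left _).trans ?_
  rw [← Matrix.mul_assoc]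
  exact (pauliString_mul _ _).mul_right _

theorem sem_doubledCat_eq_cat {F : (doubledCat B n C M).circuit.Fault}
    {k : DoubledOutcome n C M → ZMod 2} {P E : Fin 2 × Fin n → Pauli} {m : Fin n → ZMod 2}
    (hC : ∀ s, (C s).circuit.sem (prepFault F s) Empty.elim (prepBits k s) ∝
      pauliString (fun i => P (s, i)) * catMap B n)
    (hM : ∀ i, (M i).circuit.sem (checkFault F i) Empty.elim (checkBits k i) ∝
      pauliString (fun s => E (s, i)) * checkMap B (checkValue k i + m i))
    {κ δ : ZMod 2} (hκ : ∀ i, checkValue k i = κ)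
    (hδ : ∀ i, m i + (B.flipPart (P (0, i)) + B.flipPart (P (1, i))) = δ) :
    (doubledCat B n C M).circuit.sem F Empty.elim k ∝
      (pauliString (outFault F + (E + P) + blockFlip B n δ) *
        catOn B (Fin 2 × Fin n)).submatrix
          (fun (x : Fin (2 * n) → ZMod 2) j => x (finProdFinEquiv j)) id := by
  refine (sem_doubledCat_of_parts hC hM).trans (ScalarEq.submatrix ?_ _ _)
  simp only [hκ, add_assoc, hδ]
  refine ((rows_measMap_const B (κ + δ)).mul_left _).trans ?_
  rw [← Matrix.mul_assoc]
  refine ((pauliString_mul _ _).trans (.of_eq (congrArg _ ?_))).mul_right _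
  -- The merged state carries a block flip by `κ + δ`; the correction removes the reported part `κ`
  -- and leaves `δ`.
  have h := zmod_two_add_self (blockFlip B n κ)
  rw [blockFlip_add]
  change outFault F + (blockFlip B n κ + (E + P)) + _ = _
  calc _ = outFault F + (E + (P + blockFlip B n δ)) + (blockFlip B n κ + blockFlip B n κ) := by
        abel
    _ = _ := by rw [h, add_zero]

theorem exists_checkValue_eq {k : DoubledOutcome n C M → ZMod 2}
    (h : ∀ i j, checkValue k i = checkValue k j) : ∃ κ, ∀ i, checkValue k i = κ := by
  rcases isEmpty_or_nonempty (Fin n) with _ | ⟨⟨j⟩⟩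
  · exact ⟨0, fun i => isEmptyElim i⟩
  · exact ⟨_, fun i => h i j⟩

theorem sem_doubledCat_outFault (hC : ∀ s, FaultTolerantCat B n (C s))
    (hM : ∀ i, FaultTolerantCheck B (M i)) {F : (doubledCat B n C M).circuit.Fault}
    (hF : ∀ s, prepFault F s = 0) (hF' : ∀ i, checkFault F i = 0)
    {k : DoubledOutcome n C M → ZMod 2} (hk : (doubledCat B n C M).Admissible k) :
    (doubledCat B n C M).circuit.sem F Empty.elim k ∝
      pauliString (fun j => outFault F (finProdFinEquiv.symm j)) * catMap B (2 * n) := by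
  obtain ⟨h1, h2, h3⟩ := doubledCat_admissible_iff.1 hk
  obtain ⟨κ, hκ⟩ := exists_checkValue_eq h3
  have h := sem_doubledCat_eq_cat (F := F) (k := k) (P := 0) (E := 0) (m := 0) (κ := κ) (δ := 0)
    (fun s => by
      rw [hF]
      refine ((hC s).sem_zero (h1 s)).trans (.of_eq ?_)
      exact (Matrix.one_mul _).symm.trans (congrArg (· * _) pauliString_zero.symm))
    (fun i => by
      rw [hF']
      refine ((hM i).sem_zero (h2 i)).trans (.of_eq ?_)
      refine (Matrix.one_mul _).symm.trans (congrArg₂ (· * ·) pauliString_zero.symm ?_)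
      rw [Pi.zero_apply, add_zero]
      rfl) hκ (fun i => by simp)
  have h0 : blockFlip B n 0 = 0 := by ext1 j; simp [blockFlip]
  rwa [h0, add_zero, add_zero, add_zero, submatrix_pauliString_mul_catOn] at h

theorem sem_doubledCat_zero (hC : ∀ s, FaultTolerantCat B n (C s))
    (hM : ∀ i, FaultTolerantCheck B (M i)) {k : DoubledOutcome n C M → ZMod 2}
    (hk : (doubledCat B n C M).Admissible k) :
    (doubledCat B n C M).circuit.sem 0 Empty.elim k ∝ catMap B (2 * n) := by
  refine (sem_doubledCat_outFault hC hM (fun _ => rfl) (fun _ => rfl) hk).trans (.of_eq ?_)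
  exact (congrArg (· * _) pauliString_zero).trans (Matrix.one_mul _)

theorem doubledCat_total (hC : ∀ s, FaultTolerantCat B n (C s)) (hCtotal : ∀ s, (C s).Total)
    (hM : ∀ i, FaultTolerantCheck B (M i)) (hMtotal : ∀ i, (M i).Total) :
    (doubledCat B n C M).Total := by
  intro k hk
  have h1 (s : Fin 2) : (C s).Admissible (prepBits k s) := hCtotal s _ (prep_ne_zero hk s)
  have h2 (i : Fin n) : (M i).Admissible (checkBits k i) := hMtotal i _ (check_ne_zero hk i)
  refine doubledCat_admissible_iff.2 ⟨h1, h2, ?_⟩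
  have h := sem_doubledCat_of_parts (F := 0) (k := k) (P := 0) (E := 0) (m := 0)
    (fun s => ((hC s).sem_zero (h1 s)).trans (.of_eq
      ((Matrix.one_mul _).symm.trans (congrArg (· * _) pauliString_zero.symm))))
    (fun i => ((hM i).sem_zero (h2 i)).trans (.of_eq
      ((Matrix.one_mul _).symm.trans (congrArg₂ (· * ·) pauliString_zero.symm
        (congrArg (checkMap B) (add_zero _).symm)))))
  have h3 := h.ne_zero_iff.1 hk
  intro i j
  -- Without faults the ideal checks project onto the reported values themselves, so a non-zero map
  -- forces these to agree.
  have h4 := eq_of_rows_measMap_ne_zero (B := B) (μ := fun i => checkValue k i) ?_ i j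
  · exact h4
  · intro h5
    refine h3 ?_
    simp only [Pi.zero_apply, map_zero, add_zero]
    rw [h5, Matrix.mul_zero]
    rfl

theorem doubledCat_exists_admissible (hC : ∀ s, FaultTolerantCat B n (C s))
    (hM : ∀ i, FaultTolerantCheck B (M i)) : ∃ k, (doubledCat B n C M).Admissible k := by
  choose kC hkC using fun s => (hC s).exists_admissible
  choose kM hkM hkM' using fun i => (hM i).exists_admissible 0
  refine ⟨Sum.elim (Sum.elim (Sum.elim (fun v => kC v.1 v.2) fun v => kM v.1 v.2) Empty.elim)
    Empty.elim, ?_⟩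
  exact doubledCat_admissible_iff.2 ⟨hkC, hkM, fun i j => (hkM' i).trans (hkM' j).symm⟩

/-- An undetectable fault of the doubled circuit acts on the cat state like a Pauli string of at
most the same weight. -/
theorem exists_pauli_of_not_detectable (hC : ∀ s, FaultTolerantCat B n (C s))
    (hCtotal : ∀ s, (C s).Total) (hM : ∀ i, FaultTolerantCheck B (M i))
    (hMtotal : ∀ i, (M i).Total) {F : (doubledCat B n C M).circuit.Fault} {t : ℕ}
    (hF : (doubledCat B n C M).circuit.GenBy F t)
    (hd : ¬ (doubledCat B n C M).circuit.Detectable F) :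
    ∃ Q : Fin (2 * n) → Pauli, {j | Q j ≠ 0}.ncard ≤ t ∧
      ∀ k, (doubledCat B n C M).Admissible k →
        (doubledCat B n C M).circuit.sem F Empty.elim k ∝ pauliString Q * catMap B (2 * n) := by
  -- Weight `0` is separate: no wire is then available for a residual check Pauli, but the fault
  -- itself is trivial.
  rcases Nat.eq_zero_or_pos t with rfl | ht
  · refine ⟨0, by simp, fun k hk => ?_⟩
    rw [hF.eq_zero, pauliString_zero, Matrix.one_mul]
    exact sem_doubledCat_zero hC hM hk
  obtain ⟨p, q, r, rfl, hp, hq, hr⟩ := genBy_doubledCat hF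
  choose P hP hPs using fun s =>
    (hC s).sem_fault (hp s) fun h => hd (detectable_of_prep h)
  choose E m hE hm hEs using fun i =>
    (hM i).sem_fault (hq i) fun h => hd (detectable_of_check h)
  let P' : Fin 2 × Fin n → Pauli := fun j => P j.1 j.2
  let E' : Fin 2 × Fin n → Pauli := fun j => E j.2 j.1
  have hCk {k} (hk : (doubledCat B n C M).Admissible k) (s : Fin 2) :
      (C s).circuit.sem (prepFault F s) Empty.elim (prepBits k s) ∝
        pauliString (fun i => P' (s, i)) * catMap B n :=
    hPs s _ ((doubledCat_admissible_iff.1 hk).1 s)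
  have hMk {k} (hk : (doubledCat B n C M).Admissible k) (i : Fin n) :
      (M i).circuit.sem (checkFault F i) Empty.elim (checkBits k i) ∝
        pauliString (fun s => E' (s, i)) * checkMap B (checkValue k i + m i) :=
    hEs i _ ((doubledCat_admissible_iff.1 hk).2.1 i)
  -- One admissible outcome `k` suffices, as the shifts do not depend on the outcome. The faulty map
  -- at `k` is, up to a Pauli, the fault-free map at the admissible outcome `k + s`, hence non-zero.
  obtain ⟨δ, hδ⟩ : ∃ δ, ∀ i, m i + (B.flipPart (P' (0, i)) + B.flipPart (P' (1, i))) = δ := by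
    rcases isEmpty_or_nonempty (Fin n) with _ | ⟨⟨j⟩⟩
    · exact ⟨0, fun i => isEmptyElim i⟩
    obtain ⟨k, hk⟩ := doubledCat_exists_admissible hC hM
    obtain ⟨κ, hκ⟩ := exists_checkValue_eq (doubledCat_admissible_iff.1 hk).2.2
    obtain ⟨X, s, hs⟩ := exists_shift (doubledCat B n C M).circuit F
    have hks := (doubledCat_total hC hCtotal hM hMtotal).admissible_add hd hs hk
    have h0 : (doubledCat B n C M).circuit.sem F Empty.elim k ≠ 0 := by
      refine (hs k).ne_zero_iff.2 ((pauliString_mul_ne_zero _ _).2 ?_)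
      exact (sem_doubledCat_zero hC hM hks).ne_zero_iff.2 (catOn_ne_zero B)
    have h1 := (sem_doubledCat_of_parts (hCk hk) (hMk hk)).ne_zero_iff.1 h0
    refine ⟨m j + (B.flipPart (P' (0, j)) + B.flipPart (P' (1, j))), fun i => ?_⟩
    have h2 := eq_of_rows_measMap_ne_zero (B := B) (μ := fun i => checkValue k i + m i +
      (B.flipPart (P' (0, i)) + B.flipPart (P' (1, i)))) (fun h5 => h1 (by
        rw [h5, Matrix.mul_zero]; rfl)) i j
    simpa only [hκ, add_assoc, add_right_inj] using h2
  obtain ⟨Q, hQ, hQs⟩ := exists_support_le_of_or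
    (flipWeight_doubled_le (B := B) (P := P') (E := E') hP hE hm hr hδ) ht
  refine ⟨fun j => Q (finProdFinEquiv.symm j), ?_, fun k hk => ?_⟩
  · refine le_trans (le_of_eq ?_) hQ
    exact Set.ncard_preimage_of_injective_subset_range (s := {j | Q j ≠ 0})
      finProdFinEquiv.symm.injective (by simp)
  · obtain ⟨κ, hκ⟩ := exists_checkValue_eq (doubledCat_admissible_iff.1 hk).2.2
    refine (sem_doubledCat_eq_cat (hCk hk) (hMk hk) hκ hδ).trans ?_
    rw [← submatrix_pauliString_mul_catOn]
    exact hQs.submatrix _ _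

end Main

/-! ### Fault equivalence of the doubled circuit -/

theorem SumOf.map {A A' : Type} [AddCommMonoid A] [AddCommMonoid A'] {S : Set A} {S' : Set A'}
    (f : A →+ A') (hf : ∀ G ∈ S, f G ∈ S') {F : A} {m : ℕ} (h : SumOf S F m) :
    SumOf S' (f F) m := by
  obtain ⟨L, hL, rfl, rfl⟩ := h
  exact ⟨L.map f, by simpa using fun G hG => hf G (hL G hG), by rw [map_list_sum], by simp⟩

theorem SumOf.comp_equiv {a a' : Type} (e : a ≃ a') {P : a' → Pauli} {m : ℕ}
    (h : SumOf {P | IsSingleFlip P} P m) :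
    SumOf {P | IsSingleFlip P} (fun j => P (e j)) m := by
  refine h.map (S' := {P | IsSingleFlip P}) (f :=
    { toFun := fun P j => P (e j), map_zero' := rfl, map_add' := fun _ _ => rfl }) ?_
  rintro P ⟨j, hj, hj'⟩
  exact ⟨e.symm j, by simpa using hj, fun j' h => hj' _ fun h' => h (by simp [← h'])⟩

section Equivalence

variable {B : CatBasis} {n : ℕ} {C : Fin 2 → Protocol Empty (Fin 0) (Fin n)}
  {M : Fin n → Protocol Unit (Fin 2) (Fin 2)}

theorem doubledCat_faultTolerant (hC : ∀ s, FaultTolerantCat B n (C s))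
    (hCtotal : ∀ s, (C s).Total) (hM : ∀ i, FaultTolerantCheck B (M i))
    (hMtotal : ∀ i, (M i).Total) : FaultTolerantCat B (2 * n) (doubledCat B n C M) := by
  intro w
  refine ⟨?_, ?_, ?_⟩
  · obtain ⟨k, hk⟩ := doubledCat_exists_admissible hC hM
    ext r
    exact ⟨fun _ => ⟨fun _ => 0, idealCat_admissible _, Subsingleton.elim _ _⟩,
      fun _ => ⟨k, hk, Subsingleton.elim _ _⟩⟩
  · intro F hF _
    refine or_iff_not_imp_left.2 fun hd => ?_
    obtain ⟨Q, hQ, hs⟩ := exists_pauli_of_not_detectable hC hCtotal hM hMtotal (genBy_wt hF) hd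
    have hG : (idealCat B (2 * n)).circuit.GenBy (Sum.elim (fun _ => 0) Q) _ :=
      GenBy.seq_right (C₂ := wires) _ (sumOf_singleFlips Q)
    refine ⟨_, hG.mem_faultGroup, hG.wt_le.trans hQ, fun k₁ k₂ hk₁ _ _ => ?_⟩
    refine (hs k₁ hk₁).trans (.of_eq ((sem_seq _ _ _ _ _).trans ?_).symm)
    exact congrArg₂ (· * ·) rfl (sem_gate_zero _ _ _ _)
  · intro G hG _
    right
    obtain ⟨Q, m, hm, hQ, hs⟩ := genBy_idealCat (genBy_wt hG)
    -- The leg faults are placed on the output wires, renumbered by `finProdFinEquiv`.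
    have hF : (doubledCat B n C M).circuit.GenBy
        (Sum.elim (fun _ => 0) fun j => Q (finProdFinEquiv j)) m :=
      GenBy.seq_right (C₂ := wires) _ (hQ.comp_equiv finProdFinEquiv)
    refine ⟨_, hF.mem_faultGroup, hF.wt_le.trans hm, fun k₁ k₂ _ hk₂ _ => ?_⟩
    have h := sem_doubledCat_outFault hC hM (F := Sum.elim (fun _ => 0) fun j =>
      Q (finProdFinEquiv j)) (fun _ => rfl) (fun _ => rfl) hk₂
    rw [hs]
    refine ScalarEq.symm (h.trans (.of_eq (congrArg (pauliString · * _) (funext fun j => ?_))))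
    exact congrArg Q (Equiv.apply_symm_apply _ _)

end Equivalence

end CatDoubling

end

theorem mainTheorem6 (B : CatDoubling.CatBasis) (n : ℕ)
    (C : Fin 2 → CatDoubling.Protocol Empty (Fin 0) (Fin n))
    (M : Fin n → CatDoubling.Protocol Unit (Fin 2) (Fin 2))
    (hC : ∀ s, CatDoubling.FaultTolerantCat B n (C s)) (hCtotal : ∀ s, (C s).Total)
    (hM : ∀ i, CatDoubling.FaultTolerantCheck B (M i)) (hMtotal : ∀ i, (M i).Total) :
    CatDoubling.FaultTolerantCat B (2 * n) (CatDoubling.doubledCat B n C M) ∧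
      (CatDoubling.doubledCat B n C M).Total :=
  ⟨CatDoubling.doubledCat_faultTolerant hC hCtotal hM hMtotal,
    CatDoubling.doubledCat_total hC hCtotal hM hMtotal⟩
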